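/- Consider a fog radio access network in the plane $\mathbb{R}^2$ with the typical user at the origin. Let $\lambda_F,\lambda_R>0$, $p_{hit}\in[0,1]$, $\lambda_{F_c}=p_{hit}\lambda_F$, $\lambda_{\tilde F_c}=(1-p_{hit})\lambda_F$. The F-APs with the requested content, the F-APs without it, and the RRHs form independent homogeneous Poisson point processes $\Phi_{F_c},\Phi_{\tilde F_c},\Phi_R$ on $\mathbb{R}^2$ with densities $\lambda_{F_c},\lambda_{\tilde F_c},\lambda_R$ and transmit powers $P_{F_c},P_{\tilde F_c},P_R>0$. The power gains $|h_x|^2$ of the links from the base stations $x$ to the user are independent $\mathrm{Exp}(1)$ variables, independent of all positions; let $r_x=\|x\|$, let $\alpha>2$ be the path loss exponent and $\sigma^2\ge 0$ the noise power. Write $S_x=P_i|h_x|^2r_x^{-\alpha}$ for $x\in\Phi_i$. Let $B\ge 0$ and $N_B\ge 2$ be integers (feedback bits and antennas per RRH), and $$\zeta=1-2^B\,\beta\!\left(2^B,\tfrac{N_B}{N_B-1}\right),\qquad \upsilon=2^{-B/(N_B-1)},\qquad \beta(x,y)=\frac{\Gamma(x)\Gamma(y)}{\Gamma(x+y)}.$$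 The SINR of the user at the base station $x$ is $$\gamma_x=\frac{S_x}{\sum_{y\ne x}S_y+\sigma^2}\quad (x\in\Phi_{F_c}\cup\Phi_{\tilde F_c}),\qquad \gamma_x=\frac{\zeta S_x}{\sum_{y\in\Phi_{F_c}\cup\Phi_{\tilde F_c}}S_y+\upsilon\sum_{y\in\Phi_R\setminus\{x\}}S_y+\sigma^2}\quad (x\in\Phi_R),$$ where the first sum is over all base stations of all three kinds other than $x$. Let $\eta_{F_c}>1$, $\eta_{\tilde F_c}>1$, $\eta_R>\zeta/\upsilon$ be SINR thresholds. The successful delivery probability of the minimal delay association policy is $$S_{\sigma^2}(\{\eta_i\},\alpha)=\mathbb{P}\Big(\bigcup_{i\in\{F_c,\tilde F_c,R\}}\ \bigcup_{x\in\Phi_i}\{\gamma_x>\eta_i\}\Big).$$ Then, in the interference-limited case, both the limit $\lim_{\sigma^2\to0^+}S_{\sigma^2}(\{\eta_i\},\alpha)$ and the value $S_0(\{\eta_i\},\alpha)$ at zero noise are equal to $$\frac{\sum_{i\in\{F_c,\tilde F_c\}}\lambda_iP_i^{2/\alpha}\eta_i^{-2/\alpha}}{C(\alpha)\sum_{i\in\{F_c,\tilde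 F_c,R\}}\lambda_iP_i^{2/\alpha}}+\frac{\lambda_R(\zeta P_R)^{2/\alpha}\eta_R^{-2/\alpha}}{C(\alpha)\left[\lambda_R(\upsilon P_R)^{2/\alpha}+\sum_{i\in\{F_c,\tilde F_c\}}\lambda_iP_i^{2/\alpha}\right]},\qquad C(\alpha)=\frac{2\pi/\alpha}{\sin(2\pi/\alpha)}.$$ Moreover, for a content length $L>0$, traffics $\rho_i\ge0$, link latencies $D_i\ge0$ and latency targets $\beta_i>D_i$ with $\eta_i=\rho_i+L/(\beta_i-D_i)$ for every $i$, let the delivery latency at $x\in\Phi_i$ be $D_x=L/(\gamma_x-\rho_i)+D_i$ if $\gamma_x>\rho_i$ and $D_x=\infty$ otherwise; then for every $\sigma^2\ge0$ one has $S_{\sigma^2}(\{\eta_i\},\alpha)=\mathbb{P}\big(\bigcup_i\bigcup_{x\in\Phi_i}\{D_x<\beta_i\}\big)$. -/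

import Mathlib

open MeasureTheory ProbabilityTheory Filter Topology
open scoped ENNReal NNReal

noncomputable section

namespace FRAN

/-- The plane in which the base stations are deployed; the typical user sits at the origin. -/
abbrev Plane : Type := EuclideanSpace ℝ (Fin 2)

/-- The three tiers of base stations: F-APs that hold the requested content, F-APs that do not,
and RRHs. -/
inductive Tier : Type
  | cached : Tier
  | uncached : Tier
  | rrh : Tier

/-- A base station label: its tier and its number within the tier. -/
abbrev Label : Type := Tier × ℕ

section Poisson

variable {Ω : Type*} [MeasurableSpace Ω]

/-- A random countable configuration is given by a random number `K ω ∈ {0, 1, …, ∞}` of points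
and by their positions `X n ω` for `n < K ω`. This is the number of its points in `B`. -/
def pointCount (K : Ω → ℕ∞) (X : ℕ → Ω → Plane) (B : Set Plane) (ω : Ω) : ℕ∞ :=
  {n : ℕ | (n : ℕ∞) < K ω ∧ X n ω ∈ B}.encard

/-- Homogeneous Poisson point process of intensity `lam` on the plane: the number of points in
a Borel set of finite area is Poisson distributed with mean `lam` times the area, and the numbers
of points in pairwise disjoint such sets are independent. -/
structure IsHomogeneousPPP (K : Ω → ℕ∞) (X : ℕ → Ω → Plane) (lam : ℝ) (μ : Measure Ω) :
    Prop where
  measurable_num : Measurable K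
  measurable_pos : ∀ n, Measurable (X n)
  law_count : ∀ B : Set Plane, MeasurableSet B → volume B ≠ ∞ →
    HasLaw (pointCount K X B)
      ((poissonMeasure (lam * (volume B).toReal).toNNReal).map (fun k : ℕ => (k : ℕ∞))) μ
  indep_count : ∀ (m : ℕ) (B : Fin m → Set Plane), (∀ j, MeasurableSet (B j)) →
    (∀ j, volume (B j) ≠ ∞) → Pairwise (fun j k => Disjoint (B j) (B k)) →
    iIndepFun (fun j => pointCount K X (B j)) μ

/-- The random network: every tier is a homogeneous Poisson point process, the tiers are
independent, and the power gains `|h|²` of all links to the typical user are independent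
`Exp(1)` variables (Rayleigh fading), independent of all positions. -/
structure Network (Ω : Type*) [MeasurableSpace Ω] (μ : Measure Ω) (lam : Tier → ℝ) where
  /-- number of base stations in each tier -/
  num : Tier → Ω → ℕ∞
  /-- positions of the base stations -/
  pos : Tier → ℕ → Ω → Plane
  /-- fading power gains of the links to the typical user -/
  gain : Tier → ℕ → Ω → ℝ
  ppp : ∀ i, IsHomogeneousPPP (num i) (pos i) (lam i) μ
  measurable_gain : ∀ i n, Measurable (gain i n)
  law_gain : ∀ i n, HasLaw (gain i n) (expMeasure 1) μ
  indep_tiers :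
    iIndepFun (β := fun _ : Tier => ℕ∞ × (ℕ → Plane))
      (fun i ω => (num i ω, fun n => pos i n ω)) μ
  indep_gain : iIndepFun (fun (q : Label) => gain q.1 q.2) μ
  indep_pos_gain :
    IndepFun (fun ω (i : Tier) => (num i ω, fun n => pos i n ω))
      (fun ω (i : Tier) (n : ℕ) => gain i n ω) μ

end Poisson

/-- Densities of the tiers: a fraction `pHit` of the F-APs holds the requested content. -/
def density (lamF lamR pHit : ℝ) : Tier → ℝ
  | .cached => pHit * lamF
  | .uncached => (1 - pHit) * lamF
  | .rrh => lamR

/-- The quantized coefficient `ζ` of the limited feedback with `B` bits and `NB` antennas. -/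
def zeta (B NB : ℕ) : ℝ :=
  1 - 2 ^ B * ProbabilityTheory.beta (2 ^ B) ((NB : ℝ) / ((NB : ℝ) - 1))

/-- The interference power coefficient `υ` of the limited feedback. -/
def upsilon (B NB : ℕ) : ℝ := (2 : ℝ) ^ (-((B : ℝ) / ((NB : ℝ) - 1)))

/-- Factor of the useful power: `ζ` if the serving base station is an RRH, else `1`. -/
def servingFactor (ζ : ℝ) : Tier → ℝ
  | .rrh => ζ
  | _ => 1

/-- Factor of the power of an interferer of tier `j` when the serving base station is of tier
`i`: `υ` between RRHs, else `1`. -/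
def interferenceFactor (υ : ℝ) : Tier → Tier → ℝ
  | .rrh, .rrh => υ
  | _, _ => 1

namespace Network

variable {Ω : Type*} [MeasurableSpace Ω] {μ : Measure Ω} {lam : Tier → ℝ}

/-- The labels that carry a base station. -/
def Active (N : Network Ω μ lam) (ω : Ω) (q : Label) : Prop := (q.2 : ℕ∞) < N.num q.1 ω

/-- Power `P |h|² r^(-α)` received at the origin from the base station `q`. -/
def rxPower (N : Network Ω μ lam) (P : Tier → ℝ) (α : ℝ) (q : Label) (ω : Ω) : ℝ :=
  P q.1 * N.gain q.1 q.2 ω * ‖N.pos q.1 q.2 ω‖ ^ (-α)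

/-- Total interference when `p` is the serving base station. -/
def interference (N : Network Ω μ lam) (P : Tier → ℝ) (α υ : ℝ) (p : Label) (ω : Ω) : ℝ≥0∞ :=
  ∑' q : {q : Label // N.Active ω q ∧ q ≠ p},
    ENNReal.ofReal (interferenceFactor υ p.1 q.1.1 * N.rxPower P α q.1 ω)

/-- SINR of the typical user at the base station `p` for noise power `σ2`. -/
def sinr (N : Network Ω μ lam) (P : Tier → ℝ) (α ζ υ σ2 : ℝ) (p : Label) (ω : Ω) : ℝ≥0∞ :=
  ENNReal.ofReal (servingFactor ζ p.1 * N.rxPower P α p ω) /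
    (N.interference P α υ p ω + ENNReal.ofReal σ2)

/-- The successful delivery probability `S({η_i}, α)` at noise power `σ2`: some base station
offers an SINR above the threshold of its tier. -/
def successProb (N : Network Ω μ lam) (P η : Tier → ℝ) (α ζ υ σ2 : ℝ) : ℝ :=
  μ.real {ω | ∃ q : Label, N.Active ω q ∧ ENNReal.ofReal (η q.1) < N.sinr P α ζ υ σ2 q ω}

/-- Delivery latency at the base station `p`: queueing and transmission latency
`L / (SINR - ρ)` for contents of length `L` and traffic `ρ`, infinite if the SINR does not
exceed `ρ`, plus the latency `D` of the backhaul or fronthaul link of its tier. -/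
def latency (N : Network Ω μ lam) (P : Tier → ℝ) (α ζ υ σ2 L : ℝ) (ρ D : Tier → ℝ)
    (p : Label) (ω : Ω) : ℝ≥0∞ :=
  ENNReal.ofReal L / (N.sinr P α ζ υ σ2 p ω - ENNReal.ofReal (ρ p.1)) + ENNReal.ofReal (D p.1)

/-- Probability that some base station offers a latency below the target `β` of its tier. -/
def latencySuccessProb (N : Network Ω μ lam) (P : Tier → ℝ) (α ζ υ σ2 L : ℝ)
    (ρ D β : Tier → ℝ) : ℝ :=
  μ.real {ω | ∃ q : Label, N.Active ω q ∧
    N.latency P α ζ υ σ2 L ρ D q ω < ENNReal.ofReal (β q.1)}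

end Network

/-- `C(α) = (2π/α) / sin(2π/α)`. -/
def pathLossConst (α : ℝ) : ℝ := (2 * Real.pi / α) / Real.sin (2 * Real.pi / α)

/-- The interference-limited closed form. -/
def closedForm (lam P η : Tier → ℝ) (α ζ υ : ℝ) : ℝ :=
  (lam .cached * P .cached ^ (2 / α) * η .cached ^ (-(2 / α)) +
      lam .uncached * P .uncached ^ (2 / α) * η .uncached ^ (-(2 / α))) /
    (pathLossConst α *
      (lam .cached * P .cached ^ (2 / α) + lam .uncached * P .uncached ^ (2 / α) +
        lam .rrh * P .rrh ^ (2 / α))) +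
  lam .rrh * (ζ * P .rrh) ^ (2 / α) * η .rrh ^ (-(2 / α)) /
    (pathLossConst α *
      (lam .rrh * (υ * P .rrh) ^ (2 / α) +
        (lam .cached * P .cached ^ (2 / α) + lam .uncached * P .uncached ^ (2 / α))))

end FRAN

end

namespace FRAN

noncomputable section

/-! The thresholds exclude two simultaneous winners. If `p` exceeds its threshold, comparing its
power with one single interferer `q` already forces `q` to be received more weakly than `p`, so two
winners would each be weaker than the other (`Network.eq_of_lt_sinr`). At zero noise the success
event is therefore a disjoint union over the stations, and its probability is the expected number of
winners, computed tier by tier.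

Given the positions, `p` wins when its `Exp(1)` gain exceeds an independent weighted sum of the
other gains. This has probability `E exp (-sum)`, the product of the factors `1 / (1 + t q)` over
the interferers (`measure_tsum_gain_lt`). It remains to average a sum over the points of a Poisson
process (`Network.lintegral_tsum_winProb`). In place of a Palm formula, the punctured plane is cut
into annuli of area `π ε`. On each annulus the serving distance is replaced by the inner or outer
radius, and the points of the server's own tier in that annulus are removed from the interference.
Their number is then independent of what is left, so the Laplace functional factorizes
(`Network.laplace`).

Scaling makes the Laplace exponent at serving distance `ρ` equal to `κ ρ ^ 2`, where `κ` is
`decayRate`; the constant comes from `lintegral_fadingExponent` and the reflection formula for `Γ`.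
Since the squared radii grow by `ε` from one annulus to the next, both bounds are geometric series,
and both tend to `lam i * π / κ` as `ε → 0`. Inserting the power ratios and summing over the tiers
gives the closed form.

The noise limit needs no formula: the events increase as the noise decreases
(`Network.tendsto_successProb`). The latency claim inverts `L / (γ - ρ) + D < β` pointwise
(`latency_lt_iff`). -/

/-! ### The function `x ↦ exp (-x)` on `[0, ∞]` -/

/-- `exp (-x)` for `x ∈ [0, ∞]`, with value `0` at `∞`. -/
def nexp (x : ℝ≥0∞) : ℝ≥0∞ := EReal.exp (-(x : EReal))

@[simp] lemma nexp_zero : nexp 0 = 1 := by simp [nexp]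

@[simp] lemma nexp_top : nexp ∞ = 0 := by simp [nexp]

lemma nexp_ofReal {x : ℝ} (hx : 0 ≤ x) : nexp (ENNReal.ofReal x) = ENNReal.ofReal (Real.exp (-x)) := by
  rw [nexp, EReal.coe_ennreal_ofReal, max_eq_left hx, ← EReal.coe_neg, EReal.exp_coe]

lemma nexp_add (x y : ℝ≥0∞) : nexp (x + y) = nexp x * nexp y := by
  rw [nexp, nexp, nexp, ← EReal.exp_add, EReal.coe_ennreal_add]
  congr 1
  rw [EReal.neg_add, sub_eq_add_neg]
  · exact Or.inl (EReal.coe_ennreal_ne_bot x)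
  · exact Or.inr (EReal.coe_ennreal_ne_bot y)

lemma nexp_sum {ι : Type*} (s : Finset ι) (f : ι → ℝ≥0∞) :
    nexp (∑ i ∈ s, f i) = ∏ i ∈ s, nexp (f i) := by
  classical
  induction s using Finset.induction_on with
  | empty => simp
  | insert a s ha ih => rw [Finset.sum_insert ha, Finset.prod_insert ha, nexp_add, ih]

lemma nexp_nat_mul (k : ℕ) (x : ℝ≥0∞) : nexp (k * x) = nexp x ^ k := by
  induction k with
  | zero => simp
  | succ k ih => rw [Nat.cast_succ, add_mul, one_mul, nexp_add, ih, pow_succ]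

lemma nexp_anti {x y : ℝ≥0∞} (h : x ≤ y) : nexp y ≤ nexp x := by
  unfold nexp
  apply EReal.exp_monotone
  rw [EReal.neg_le_neg_iff]
  exact_mod_cast h

lemma nexp_le_one (x : ℝ≥0∞) : nexp x ≤ 1 := by
  simpa using nexp_anti (zero_le (a := x))

lemma nexp_ne_top (x : ℝ≥0∞) : nexp x ≠ ∞ := ne_top_of_le_ne_top ENNReal.one_ne_top (nexp_le_one x)

lemma continuous_nexp : Continuous nexp :=
  ENNReal.continuous_exp.comp (continuous_neg.comp continuous_coe_ennreal_ereal)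

@[fun_prop]
lemma measurable_nexp : Measurable nexp := continuous_nexp.measurable

/-! ### Poisson moments -/

lemma lintegral_poissonMeasure (r : ℝ≥0) (f : ℕ → ℝ≥0∞) :
    ∫⁻ k, f k ∂poissonMeasure r =
      ∑' k : ℕ, ENNReal.ofReal (Real.exp (-r) * r ^ k / k.factorial) * f k := by
  rw [poissonMeasure, lintegral_sum_measure]
  simp [lintegral_smul_measure]

/-- Probability generating function of the Poisson law at `q = exp (-c)`. The value `c = ∞` is
allowed and gives the void probability. -/
lemma lintegral_nexp_poissonMeasure (r : ℝ≥0) (c : ℝ≥0∞) :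
    ∫⁻ k, nexp (k * c) ∂poissonMeasure r = nexp (r * (1 - nexp c)) := by
  obtain ⟨q, hq⟩ : ∃ q : ℝ≥0, nexp c = q := ⟨_, (ENNReal.coe_toNNReal (nexp_ne_top c)).symm⟩
  have hq1 : q ≤ 1 := by exact_mod_cast hq ▸ nexp_le_one c
  have hR : (r : ℝ≥0∞) * (1 - nexp c) = ENNReal.ofReal (r * (1 - q)) := by
    rw [hq, ENNReal.ofReal_mul (by positivity), ENNReal.ofReal_sub _ (by positivity)]
    simp
  rw [hR, lintegral_poissonMeasure r fun k => nexp (k * c),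
    nexp_ofReal (mul_nonneg r.coe_nonneg (sub_nonneg.2 (by exact_mod_cast hq1)))]
  have h : HasSum (fun k : ℕ => Real.exp (-r) * (r * q : ℝ) ^ k / k.factorial)
      (Real.exp (-(r * (1 - q)))) := by
    convert! (NormedSpace.expSeries_div_hasSum_exp (r * q : ℝ)).mul_left (Real.exp (-r)) using 1
    · simp_rw [mul_div_assoc]
    · rw [← Real.exp_eq_exp_ℝ, ← Real.exp_add]; congr 1; ring
  rw [← h.tsum_eq, ENNReal.ofReal_tsum_of_nonneg (fun k => by positivity) h.summable]
  congr 1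
  ext k
  rw [nexp_nat_mul, hq, ← ENNReal.ofReal_coe_nnreal, ← ENNReal.ofReal_pow q.coe_nonneg,
    ← ENNReal.ofReal_mul (by positivity)]
  congr 1
  rw [mul_pow]; ring

lemma lintegral_cast_poissonMeasure (r : ℝ≥0) :
    ∫⁻ k, (k : ℝ≥0∞) ∂poissonMeasure r = r := by
  -- Total mass one as a series: after dropping the term `k = 0` and shifting by one, the mean is
  -- `r` times this series.
  have h1 := lintegral_poissonMeasure r (fun _ => 1)
  rw [lintegral_poissonMeasure, tsum_eq_zero_add' ENNReal.summable]
  simp only [lintegral_const, measure_univ, mul_one] at h1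
  simp only [Nat.cast_zero, mul_zero, zero_add]
  conv_rhs => rw [← mul_one (r : ℝ≥0∞), h1, ← ENNReal.tsum_mul_left]
  congr 1
  ext k
  rw [← ENNReal.ofReal_natCast (k + 1), ← ENNReal.ofReal_coe_nnreal,
    ← ENNReal.ofReal_mul (by positivity), ← ENNReal.ofReal_mul (by positivity)]
  congr 1
  rw [Nat.factorial_succ]
  push_cast
  field_simp
  ring

/-! ### Counting measure of a configuration -/

/-- Sum of `g` over the points `x n`, `n < K`. -/
def pointSum (K : ℕ∞) (x : ℕ → Plane) (g : Plane → ℝ≥0∞) : ℝ≥0∞ :=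
  ∑' n : ℕ, if (n : ℕ∞) < K then g (x n) else 0

/-- The counting measure of the points `x n`, `n < K`. -/
def pointMeasure (K : ℕ∞) (x : ℕ → Plane) : Measure Plane :=
  Measure.sum fun n : ℕ => (if (n : ℕ∞) < K then (1 : ℝ≥0∞) else 0) • Measure.dirac (x n)

/-- Gives sums over points access to simple functions and monotone convergence. -/
lemma lintegral_pointMeasure (K : ℕ∞) (x : ℕ → Plane) {g : Plane → ℝ≥0∞} (hg : Measurable g) :
    ∫⁻ y, g y ∂pointMeasure K x = pointSum K x g := by
  rw [pointMeasure, lintegral_sum_measure, pointSum]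
  congr 1
  ext n
  rw [lintegral_smul_measure, lintegral_dirac' _ hg]
  split_ifs <;> simp

variable {Ω : Type*} {K : Ω → ℕ∞} {X : ℕ → Ω → Plane}

lemma pointMeasure_apply (ω : Ω) {B : Set Plane} (hB : MeasurableSet B) :
    pointMeasure (K ω) (fun n => X n ω) B = (pointCount K X B ω : ℝ≥0∞) := by
  rw [← lintegral_indicator_one hB, lintegral_pointMeasure _ _ (measurable_one.indicator hB),
    pointSum, pointCount, ← ENNReal.tsum_set_one, tsum_subtype _ (fun _ => (1 : ℝ≥0∞))]
  congr 1
  ext n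
  by_cases h1 : (n : ℕ∞) < K ω <;> by_cases h2 : X n ω ∈ B <;> simp [h1, h2]

/-- The value `0` is left out because its level set may have infinite area, where the law of the
count is not prescribed. -/
lemma pointSum_simpleFunc (s : SimpleFunc Plane ℝ≥0∞) (ω : Ω) :
    pointSum (K ω) (fun n => X n ω) s =
      ∑ c ∈ s.range with c ≠ 0, c * (pointCount K X (s ⁻¹' {c}) ω : ℝ≥0∞) := by
  rw [← lintegral_pointMeasure _ _ s.measurable, s.lintegral_eq_lintegral, SimpleFunc.lintegral,
    Finset.sum_filter]
  refine Finset.sum_congr rfl fun c _ => ?_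
  rw [pointMeasure_apply _ (s.measurableSet_fiber c)]
  split_ifs with h
  · rfl
  · simp [not_not.1 h]

variable [MeasurableSpace Ω] {μ : Measure Ω}

lemma measurable_pointSum (hK : Measurable K) (hX : ∀ n, Measurable (X n)) {g : Plane → ℝ≥0∞}
    (hg : Measurable g) : Measurable fun ω => pointSum (K ω) (fun n => X n ω) g := by
  unfold pointSum
  refine Measurable.tsum fun n => Measurable.ite ?_ (hg.comp (hX n)) measurable_const
  exact hK (MeasurableSet.of_discrete (s := {k : ℕ∞ | (n : ℕ∞) < k}))

lemma measurable_pointCount (hK : Measurable K) (hX : ∀ n, Measurable (X n)) {B : Set Plane}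
    (hB : MeasurableSet B) : Measurable (pointCount K X B) := by
  have h := measurable_pointSum hK hX (measurable_one.indicator hB : Measurable (B.indicator 1))
  refine measurable_to_countable' fun k => ?_
  convert h (measurableSet_singleton (k : ℝ≥0∞)) using 1
  ext ω
  have := pointMeasure_apply (K := K) (X := X) ω hB
  rw [← lintegral_indicator_one hB, lintegral_pointMeasure _ _ (measurable_one.indicator hB)] at this
  simp [this]

/-! ### Laplace functional of a single Poisson process -/

lemma IsHomogeneousPPP.lintegral_count {lam : ℝ} (h : IsHomogeneousPPP K X lam μ) {B : Set Plane}
    (hB : MeasurableSet B) (hvol : volume B ≠ ∞) (φ : ℕ∞ → ℝ≥0∞) :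
    ∫⁻ ω, φ (pointCount K X B ω) ∂μ =
      ∫⁻ k : ℕ, φ k ∂poissonMeasure (lam * (volume B).toReal).toNNReal := by
  have h1 := (h.law_count B hB hvol).map_eq
  have h2 : ∫⁻ k, φ k ∂(μ.map (pointCount K X B)) = ∫⁻ ω, φ (pointCount K X B ω) ∂μ :=
    lintegral_map .of_discrete (measurable_pointCount h.measurable_num h.measurable_pos hB)
  rw [← h2, h1, lintegral_map .of_discrete .of_discrete]

lemma IsHomogeneousPPP.iIndepFun_count {lam : ℝ} (h : IsHomogeneousPPP K X lam μ)
    {ι : Type*} [Fintype ι] (B : ι → Set Plane) (hB : ∀ j, MeasurableSet (B j))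
    (hvol : ∀ j, volume (B j) ≠ ∞) (hd : Pairwise fun j k => Disjoint (B j) (B k)) :
    iIndepFun (fun j => pointCount K X (B j)) μ := by
  have e := Fintype.equivFin ι
  have := (h.indep_count _ (fun k => B (e.symm k)) (fun j => hB _) (fun j => hvol _)
    (fun j k hjk => hd (e.symm.injective.ne hjk))).precomp e.injective
  simpa using this

/-- `A` and the nonzero level sets of `s` are disjoint and of finite area, so their counts are
independent and each level set contributes a Poisson generating function. The weight `φ` will be the
number of points in `A` or the indicator that it is one. -/
lemma IsHomogeneousPPP.laplace_simpleFunc {lam : ℝ} (hlam : 0 ≤ lam)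
    (h : IsHomogeneousPPP K X lam μ) {A : Set Plane} (hA : MeasurableSet A)
    (hAvol : volume A ≠ ∞) (φ : ℕ∞ → ℝ≥0∞) (s : SimpleFunc Plane ℝ≥0∞)
    (hs : ∀ c, c ≠ 0 → volume (s ⁻¹' {c}) ≠ ∞) (hsA : ∀ y ∈ A, s y = 0) :
    ∫⁻ ω, φ (pointCount K X A ω) * nexp (pointSum (K ω) (fun n => X n ω) s) ∂μ =
      (∫⁻ ω, φ (pointCount K X A ω) ∂μ) *
        nexp (ENNReal.ofReal lam * ∫⁻ y, (1 - nexp (s y))) := by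
  classical
  let T := {c // c ∈ s.range.filter (· ≠ 0)}
  let _ : Fintype T := inferInstanceAs (Fintype {c // c ∈ s.range.filter (· ≠ 0)})
  -- `none` stands for `A`, `some c` for the level set of `c`.
  let B : Option T → Set Plane := fun o => o.elim A fun c => s ⁻¹' {c.1}
  have hT : ∀ c : T, c.1 ≠ 0 := fun c => (Finset.mem_filter.1 c.2).2
  have hB : ∀ o, MeasurableSet (B o) := by
    rintro (_ | c)
    · exact hA
    · exact s.measurableSet_fiber _
  have hBv : ∀ o, volume (B o) ≠ ∞ := by
    rintro (_ | c)
    · exact hAvol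
    · exact hs _ (hT c)
  have hd : Pairwise fun j k => Disjoint (B j) (B k) := by
    have key : ∀ c : T, Disjoint A (s ⁻¹' {c.1}) := fun c =>
      Set.disjoint_left.2 fun y hy hc => hT c (by rw [← Set.mem_singleton_iff.1 hc, hsA y hy])
    rintro (_ | c) (_ | d) hne
    · exact absurd rfl hne
    · exact key d
    · exact (key c).symm
    · refine Set.disjoint_left.2 fun y hy hc => hne ?_
      have h1 : s y = c.1 := hy
      have h2 : s y = d.1 := hc
      rw [Subtype.ext (h1.symm.trans h2)]
  let ψ : Option T → ℕ∞ → ℝ≥0∞ := fun o => o.elim φ fun c k => nexp (c.1 * (k : ℝ≥0∞))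
  have hind := (h.iIndepFun_count B hB hBv hd).comp ψ fun _ => .of_discrete
  have hprod := lintegral_prod_eq_prod_lintegral_of_indepFun Finset.univ _ hind
    (fun o => Measurable.comp .of_discrete
      (measurable_pointCount h.measurable_num h.measurable_pos (hB o)))
  simp only [Fintype.prod_option, Function.comp_apply] at hprod
  have hval : ∀ c : T, ∫⁻ ω, ψ (some c) (pointCount K X (B (some c)) ω) ∂μ =
      nexp (ENNReal.ofReal lam * ((1 - nexp c.1) * volume (s ⁻¹' {c.1}))) := by
    intro c
    rw [h.lintegral_count (hB _) (hBv _)]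
    have : ∀ k : ℕ, ψ (some c) k = nexp (k * c.1) := fun k => by simp [ψ, mul_comm]
    simp_rw [this]
    rw [lintegral_nexp_poissonMeasure]
    congr 1
    have : ((lam * (volume (B (some c))).toReal).toNNReal : ℝ≥0∞) =
        ENNReal.ofReal lam * volume (s ⁻¹' {c.1}) := by
      change ENNReal.ofReal _ = _
      rw [ENNReal.ofReal_mul hlam, ENNReal.ofReal_toReal (hBv _)]
      rfl
    rw [this]; ring
  simp only [hval, ← nexp_sum] at hprod
  have hI : ∫⁻ y, (1 - nexp (s y)) =
      ∑ c : T, (1 - nexp c.1) * volume (s ⁻¹' {c.1}) := by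
    have := s.map_lintegral (μ := volume) (fun c => 1 - nexp c)
    rw [← SimpleFunc.lintegral_eq_lintegral] at this
    simp only [SimpleFunc.map_apply] at this
    rw [this]
    refine Eq.trans ?_ (Finset.sum_coe_sort (s.range.filter (· ≠ 0))
      (fun c => (1 - nexp c) * volume (s ⁻¹' {c}))).symm
    rw [Finset.sum_filter]
    refine Finset.sum_congr rfl fun c _ => ?_
    split_ifs with h
    · rfl
    · simp [not_not.1 h]
  rw [hI, Finset.mul_sum]
  refine Eq.trans ?_ hprod
  refine lintegral_congr fun ω => ?_
  rw [pointSum_simpleFunc, ← Finset.sum_coe_sort (s.range.filter (· ≠ 0))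
    (fun c => c * (pointCount K X (s ⁻¹' {c}) ω : ℝ≥0∞)), nexp_sum]
  rfl

lemma tendsto_pointSum (k : ℕ∞) (x : ℕ → Plane) {g : ℕ → Plane → ℝ≥0∞} {f : Plane → ℝ≥0∞}
    (hmono : ∀ y, Monotone fun n => g n y)
    (hlim : ∀ y, Tendsto (fun n => g n y) atTop (𝓝 (f y)))
    (hg : ∀ n, Measurable (g n)) (hf : Measurable f) :
    Tendsto (fun n => pointSum k x (g n)) atTop (𝓝 (pointSum k x f)) := by
  simp_rw [← lintegral_pointMeasure k x (hg _), ← lintegral_pointMeasure k x hf]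
  exact lintegral_tendsto_of_tendsto_of_monotone (fun n => (hg n).aemeasurable)
    (ae_of_all _ hmono) (ae_of_all _ hlim)

lemma IsHomogeneousPPP.laplace {lam : ℝ} (hlam : 0 ≤ lam) (h : IsHomogeneousPPP K X lam μ)
    {A : Set Plane} (hA : MeasurableSet A) (hAvol : volume A ≠ ∞) (φ : ℕ∞ → ℝ≥0∞)
    (hφ : ∫⁻ ω, φ (pointCount K X A ω) ∂μ ≠ ∞) {g : Plane → ℝ≥0∞} (hg : Measurable g)
    (hgA : ∀ y ∈ A, g y = 0) :
    ∫⁻ ω, φ (pointCount K X A ω) * nexp (pointSum (K ω) (fun n => X n ω) g) ∂μ =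
      (∫⁻ ω, φ (pointCount K X A ω) ∂μ) *
        nexp (ENNReal.ofReal lam * ∫⁻ y, (1 - nexp (g y))) := by
  -- Restricting to balls gives the nonzero level sets finite area.
  let s : ℕ → SimpleFunc Plane ℝ≥0∞ := fun n =>
    (SimpleFunc.eapprox g n).restrict (Metric.ball 0 n)
  have hs : ∀ n y, s n y = (Metric.ball (0 : Plane) n).indicator (SimpleFunc.eapprox g n) y :=
    fun n y => by rw [SimpleFunc.restrict_apply _ Metric.isOpen_ball.measurableSet]
  have hle : ∀ n y, SimpleFunc.eapprox g n y ≤ g y := fun n y => by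
    rw [← SimpleFunc.iSup_eapprox_apply hg y]
    exact le_iSup (fun n => SimpleFunc.eapprox g n y) n
  have hmono : ∀ y, Monotone fun n => s n y := by
    intro y m n hmn
    simp only [hs]
    refine (Set.indicator_le_indicator_of_subset
      (Metric.ball_subset_ball (Nat.cast_le.2 hmn)) (fun _ => zero_le) y).trans ?_
    exact Set.indicator_le_indicator (SimpleFunc.monotone_eapprox g hmn y)
  have hlim : ∀ y, Tendsto (fun n => s n y) atTop (𝓝 (g y)) := by
    intro y
    refine (SimpleFunc.tendsto_eapprox hg y).congr' ?_
    obtain ⟨N, hN⟩ := exists_nat_gt ‖y‖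
    filter_upwards [eventually_ge_atTop N] with n hn
    rw [hs, Set.indicator_of_mem]
    rw [mem_ball_zero_iff]
    exact hN.trans_le (by exact_mod_cast hn)
  have hA0 : ∀ n, ∀ y ∈ A, s n y = 0 := by
    intro n y hy
    rw [hs]
    by_cases hb : y ∈ Metric.ball (0 : Plane) n
    · rw [Set.indicator_of_mem hb]
      exact le_antisymm ((hle n y).trans (hgA y hy).le) zero_le
    · rw [Set.indicator_of_notMem hb]
  have hfin : ∀ n c, c ≠ 0 → volume (s n ⁻¹' {c}) ≠ ∞ := by
    intro n c hc
    refine ne_top_of_le_ne_top (measure_ball_lt_top (x := (0 : Plane)) (r := n)).ne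
      (measure_mono fun y hy => ?_)
    by_contra hb
    apply hc
    rw [← Set.mem_singleton_iff.1 hy, hs, Set.indicator_of_notMem hb]
  have hcm := measurable_pointCount h.measurable_num h.measurable_pos hA
  have hφm : Measurable fun ω => φ (pointCount K X A ω) := Measurable.comp .of_discrete hcm
  have L1 : Tendsto (fun n => ∫⁻ ω, φ (pointCount K X A ω) *
      nexp (pointSum (K ω) (fun n => X n ω) (s n)) ∂μ) atTop
      (𝓝 (∫⁻ ω, φ (pointCount K X A ω) * nexp (pointSum (K ω) (fun n => X n ω) g) ∂μ)) := by
    refine tendsto_lintegral_of_dominated_convergence (fun ω => φ (pointCount K X A ω))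
      (fun n => hφm.mul (measurable_nexp.comp
        (measurable_pointSum h.measurable_num h.measurable_pos (s n).measurable)))
      (fun n => ae_of_all _ fun ω => mul_le_of_le_one_right' (nexp_le_one _)) hφ ?_
    filter_upwards [ae_lt_top hφm hφ] with ω hω
    exact ENNReal.Tendsto.const_mul ((continuous_nexp.tendsto _).comp
      (tendsto_pointSum _ _ hmono hlim (fun n => (s n).measurable) hg)) (Or.inr hω.ne)
  have L2 : Tendsto (fun n => ∫⁻ y, (1 - nexp (s n y))) atTop (𝓝 (∫⁻ y, (1 - nexp (g y)))) := by
    refine lintegral_tendsto_of_tendsto_of_monotone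
      (fun n => (measurable_const.sub (measurable_nexp.comp (s n).measurable)).aemeasurable)
      (ae_of_all _ fun y m n hmn => tsub_le_tsub_left (nexp_anti (hmono y hmn)) 1)
      (ae_of_all _ fun y => ?_)
    exact ENNReal.Tendsto.sub tendsto_const_nhds ((continuous_nexp.tendsto _).comp (hlim y))
      (Or.inl ENNReal.one_ne_top)
  refine tendsto_nhds_unique L1 ?_
  simp_rw [fun n => h.laplace_simpleFunc hlam hA hAvol φ (s n) (hfin n) (hA0 n)]
  refine ENNReal.Tendsto.const_mul ((continuous_nexp.tendsto _).comp ?_) (Or.inr hφ)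
  exact ENNReal.Tendsto.const_mul L2 (Or.inr ENNReal.ofReal_ne_top)

/-! ### The base station tiers -/

instance : DecidableEq Tier := fun a b => by
  cases a <;> cases b <;> first | exact isTrue rfl | exact isFalse (fun h => nomatch h)

instance : Fintype Tier where
  elems := {Tier.cached, Tier.uncached, Tier.rrh}
  complete := by rintro (_ | _ | _) <;> simp

lemma sum_tier {M : Type*} [AddCommMonoid M] (f : Tier → M) :
    ∑ i, f i = f .cached + f .uncached + f .rrh := by
  change ∑ i ∈ {Tier.cached, Tier.uncached, Tier.rrh}, f i = _
  rw [Finset.sum_insert (by simp), Finset.sum_insert (by simp), Finset.sum_singleton, add_assoc]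

/-- A configuration of base stations: their number and positions in every tier. -/
abbrev Config : Type := Tier → ℕ∞ × (ℕ → Plane)

/-- Sum of `g i y` over the base stations of a configuration. -/
def configSum (c : Config) (g : Tier → Plane → ℝ≥0∞) : ℝ≥0∞ :=
  ∑ i, pointSum (c i).1 (c i).2 (g i)

/-- The configuration of a network. -/
def Network.config {Ω : Type*} [MeasurableSpace Ω] {μ : Measure Ω} {lam : Tier → ℝ}
    (N : Network Ω μ lam) (ω : Ω) : Config := fun i => (N.num i ω, fun n => N.pos i n ω)

/-- Number of points of a tier in `A`. -/
def tierCount (c : Config) (i : Tier) (A : Set Plane) : ℕ∞ :=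
  pointCount (fun c : Config => (c i).1) (fun n c => (c i).2 n) A c

/-! ### Joint Laplace functional of the three tiers -/

section Laplace

variable {Ω : Type*} [MeasurableSpace Ω] {μ : Measure Ω} {lam : Tier → ℝ}

lemma Network.lintegral_tierCount (N : Network Ω μ lam) {i : Tier} {A : Set Plane}
    (hA : MeasurableSet A) (hAvol : volume A ≠ ∞) (φ : ℕ∞ → ℝ≥0∞) :
    ∫⁻ ω, φ (tierCount (N.config ω) i A) ∂μ =
      ∫⁻ k : ℕ, φ k ∂poissonMeasure (lam i * (volume A).toReal).toNNReal :=
  (N.ppp i).lintegral_count hA hAvol φ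

lemma Network.laplace (N : Network Ω μ lam) (hlam : ∀ i, 0 ≤ lam i) {i : Tier} {A : Set Plane}
    (hA : MeasurableSet A) (hAvol : volume A ≠ ∞) (φ : ℕ∞ → ℝ≥0∞)
    (hφ : ∫⁻ ω, φ (tierCount (N.config ω) i A) ∂μ ≠ ∞) {g : Tier → Plane → ℝ≥0∞}
    (hg : ∀ j, Measurable (g j)) (hgA : ∀ y ∈ A, g i y = 0) :
    ∫⁻ ω, φ (tierCount (N.config ω) i A) * nexp (configSum (N.config ω) g) ∂μ =
      (∫⁻ ω, φ (tierCount (N.config ω) i A) ∂μ) *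
        nexp (∑ j, ENNReal.ofReal (lam j) * ∫⁻ y, (1 - nexp (g j y))) := by
  have : IsProbabilityMeasure μ := N.indep_tiers.isProbabilityMeasure
  let F : Tier → ℕ∞ × (ℕ → Plane) → ℝ≥0∞ := fun j c =>
    (if j = i then φ (pointCount Prod.fst (fun n (c : ℕ∞ × (ℕ → Plane)) => c.2 n) A c) else 1) *
      nexp (pointSum c.1 c.2 (g j))
  have hX : ∀ n, Measurable fun c : ℕ∞ × (ℕ → Plane) => c.2 n := fun n =>
    (measurable_pi_apply n).comp measurable_snd
  have hF : ∀ j, Measurable (F j) := by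
    intro j
    refine Measurable.mul ?_ (measurable_nexp.comp (measurable_pointSum measurable_fst hX (hg j)))
    split_ifs
    · exact Measurable.comp .of_discrete (measurable_pointCount measurable_fst hX hA)
    · exact measurable_const
  have hconf : ∀ j, Measurable fun ω => N.config ω j := fun j =>
    (N.ppp j).measurable_num.prodMk (measurable_pi_lambda _ (N.ppp j).measurable_pos)
  have hprod := lintegral_prod_eq_prod_lintegral_of_indepFun Finset.univ _
    (N.indep_tiers.comp F hF) (fun j => (hF j).comp (hconf j))
  have hfac : ∀ j, ∫⁻ ω, F j (N.config ω j) ∂μ =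
      (if j = i then ∫⁻ ω, φ (tierCount (N.config ω) i A) ∂μ else 1) *
        nexp (ENNReal.ofReal (lam j) * ∫⁻ y, (1 - nexp (g j y))) := by
    intro j
    by_cases hj : j = i
    · subst hj
      simp only [F, if_true]
      exact (N.ppp j).laplace (hlam j) hA hAvol φ hφ (hg j) hgA
    · simp only [F, if_neg hj]
      -- The other tiers carry no count: empty set and constant weight.
      have := (N.ppp j).laplace (hlam j) (A := ∅) MeasurableSet.empty (by simp) (fun _ => 1)
        (by simp) (hg j) (by simp)
      simpa [Network.config] using this
  have hprod' := hprod.trans (Finset.prod_congr rfl fun j _ => hfac j)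
  rw [Finset.prod_mul_distrib, Finset.prod_ite_eq' Finset.univ i, if_pos (Finset.mem_univ i),
    ← nexp_sum] at hprod'
  rw [← hprod']
  refine lintegral_congr fun ω => ?_
  simp only [F, Function.comp_apply]
  rw [Finset.prod_mul_distrib, Finset.prod_ite_eq' Finset.univ i, if_pos (Finset.mem_univ i),
    ← nexp_sum]
  rfl

end Laplace

/-! ### The path loss integral -/

lemma lintegral_exp_neg_mul_norm_rpow {α c : ℝ} (hα : 1 ≤ α) (hc : 0 < c) :
    ∫⁻ y : Plane, ENNReal.ofReal (Real.exp (-c * ‖y‖ ^ α)) =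
      ENNReal.ofReal (Real.pi * c ^ (-2 / α) * Real.Gamma (2 / α + 1)) := by
  have h1 := Complex.integral_exp_neg_mul_rpow hα hc
  have hpos : 0 < Real.pi * c ^ (-2 / α) * Real.Gamma (2 / α + 1) :=
    mul_pos (mul_pos Real.pi_pos (Real.rpow_pos_of_pos hc _)) (Real.Gamma_pos_of_pos (by positivity))
  rw [← h1, ofReal_integral_eq_lintegral_ofReal (Integrable.of_integral_ne_zero (h1 ▸ hpos.ne'))
    (ae_of_all _ fun x => (Real.exp_pos _).le)]
  -- The integral is known over `ℂ`; the basis `1, I` transports it isometrically to the plane.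
  have hmp := (Complex.orthonormalBasisOneI.repr).measurePreserving
  rw [← hmp.lintegral_comp (by fun_prop)]
  simp

lemma lintegral_exp_neg_mul {x : ℝ} (hx : 0 < x) :
    ∫⁻ t in Set.Ioi (0 : ℝ), ENNReal.ofReal (Real.exp (-(x * t))) = ENNReal.ofReal (1 / x) := by
  have h1 := Real.integral_rpow_mul_exp_neg_mul_Ioi one_pos hx
  simp only [sub_self, Real.rpow_zero, one_mul, Real.rpow_one, Real.Gamma_one, mul_one] at h1
  rw [← h1, ofReal_integral_eq_lintegral_ofReal
    (Integrable.of_integral_ne_zero (h1 ▸ (by positivity)))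
    (ae_of_all _ fun x => (Real.exp_pos _).le)]

lemma lintegral_rpow_mul_exp_neg {s : ℝ} (hs : 0 < s) :
    ∫⁻ t in Set.Ioi (0 : ℝ), ENNReal.ofReal (t ^ (s - 1) * Real.exp (-t)) =
      ENNReal.ofReal (Real.Gamma s) := by
  have h1 := Real.integral_rpow_mul_exp_neg_mul_Ioi hs one_pos
  simp only [one_mul, div_one, Real.one_rpow] at h1
  rw [← h1, ofReal_integral_eq_lintegral_ofReal
    (Integrable.of_integral_ne_zero (h1 ▸ (Real.Gamma_pos_of_pos hs).ne'))]
  filter_upwards [ae_restrict_mem measurableSet_Ioi] with t ht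
  have : 0 < t := ht
  positivity

/-- Euler's reflection formula at `s = 2 / α`, after `Γ (s + 1) = s Γ s`. -/
lemma Gamma_mul_Gamma_eq_pathLossConst {α : ℝ} (hα : 2 < α) :
    Real.Gamma (2 / α + 1) * Real.Gamma (1 - 2 / α) = pathLossConst α := by
  rw [Real.Gamma_add_one (by positivity), mul_assoc, Real.Gamma_mul_Gamma_one_sub, pathLossConst]
  ring_nf

lemma pathLossConst_pos {α : ℝ} (hα : 2 < α) : 0 < pathLossConst α := by
  rw [← Gamma_mul_Gamma_eq_pathLossConst hα]
  exact mul_pos (Real.Gamma_pos_of_pos (by positivity))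
    (Real.Gamma_pos_of_pos (by rw [sub_pos, div_lt_one (by linarith)]; exact hα))

/-- Write `1 / x` as `∫ exp (-x t) dt` and apply Tonelli. The integral over the plane yields `t ^
(-2 / α)`, and the one over `t` is then `Γ (1 - 2 / α)`, finite because `α > 2`. -/
lemma lintegral_one_div_one_add_mul_norm_rpow {α b : ℝ} (hα : 2 < α) (hb : 0 < b) :
    ∫⁻ y : Plane, ENNReal.ofReal (1 / (1 + b * ‖y‖ ^ α)) =
      ENNReal.ofReal (Real.pi * b ^ (-2 / α) * pathLossConst α) := by
  have hδ : 0 < 1 - 2 / α := by rw [sub_pos, div_lt_one (by linarith)]; exact hα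
  have h1 : ∀ y : Plane, ENNReal.ofReal (1 / (1 + b * ‖y‖ ^ α)) =
      ∫⁻ t in Set.Ioi (0 : ℝ), ENNReal.ofReal (Real.exp (-((1 + b * ‖y‖ ^ α) * t))) := fun y =>
    (lintegral_exp_neg_mul (by positivity)).symm
  simp_rw [h1]
  rw [lintegral_lintegral_swap (by fun_prop)]
  have h2 : ∀ t ∈ Set.Ioi (0 : ℝ),
      ∫⁻ y : Plane, ENNReal.ofReal (Real.exp (-((1 + b * ‖y‖ ^ α) * t))) =
        ENNReal.ofReal (Real.pi * b ^ (-2 / α) * Real.Gamma (2 / α + 1)) *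
          ENNReal.ofReal (t ^ (1 - 2 / α - 1) * Real.exp (-t)) := by
    intro t ht
    have ht : 0 < t := ht
    have : ∀ y : Plane, ENNReal.ofReal (Real.exp (-((1 + b * ‖y‖ ^ α) * t))) =
        ENNReal.ofReal (Real.exp (-t)) * ENNReal.ofReal (Real.exp (-(b * t) * ‖y‖ ^ α)) := by
      intro y
      rw [← ENNReal.ofReal_mul (Real.exp_pos _).le, ← Real.exp_add]
      congr 2; ring
    simp_rw [this]
    rw [lintegral_const_mul _ (by fun_prop),
      lintegral_exp_neg_mul_norm_rpow (by linarith) (mul_pos hb ht),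
      ← ENNReal.ofReal_mul (Real.exp_pos _).le, ← ENNReal.ofReal_mul]
    · congr 1
      rw [Real.mul_rpow hb.le ht.le, show 1 - 2 / α - 1 = -2 / α by ring]
      ring
    · have := Real.Gamma_pos_of_pos (show 0 < 2 / α + 1 by positivity)
      positivity
  rw [setLIntegral_congr_fun measurableSet_Ioi h2, lintegral_const_mul _ (by fun_prop),
    lintegral_rpow_mul_exp_neg hδ, ← ENNReal.ofReal_mul, mul_assoc,
    Gamma_mul_Gamma_eq_pathLossConst hα]
  have := Real.Gamma_pos_of_pos (show 0 < 2 / α + 1 by positivity)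
  positivity

/-- Exponent of the Laplace transform of Rayleigh faded interference: contribution of an
interferer at `y`, of relative power `a`, to the serving distance `ρ`. -/
def fadingExponent (α a ρ : ℝ) (y : Plane) : ℝ≥0∞ :=
  ENNReal.ofReal (Real.log (1 + a * ρ ^ α * ‖y‖ ^ (-α)))

/-- The reason for the logarithm in `fadingExponent`: Rayleigh factors multiply, so their exponents
can be summed over points. -/
lemma nexp_ofReal_log {t : ℝ} (ht : 0 ≤ t) :
    nexp (ENNReal.ofReal (Real.log (1 + t))) = ENNReal.ofReal (1 / (1 + t)) := by
  rw [nexp_ofReal (Real.log_nonneg (by linarith)), Real.exp_neg, Real.exp_log (by linarith),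
    one_div]

@[fun_prop]
lemma measurable_fadingExponent (α a ρ : ℝ) : Measurable (fadingExponent α a ρ) := by
  unfold fadingExponent; fun_prop

lemma fadingExponent_mono {α a ρ ρ' : ℝ} (hα : 0 ≤ α) (ha : 0 ≤ a) (hρ : 0 ≤ ρ) (h : ρ ≤ ρ')
    (y : Plane) : fadingExponent α a ρ y ≤ fadingExponent α a ρ' y := by
  have := Real.rpow_nonneg (norm_nonneg y) (-α)
  have := Real.rpow_nonneg hρ α
  refine ENNReal.ofReal_le_ofReal (Real.log_le_log (by positivity) ?_)
  gcongr

/-- Off the origin, `1 - 1 / (1 + t) = 1 / (1 + t⁻¹)` with `t⁻¹ = (a ρ ^ α)⁻¹ ‖y‖ ^ α`, which is the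
previous integral. -/
lemma lintegral_fadingExponent {α a ρ : ℝ} (hα : 2 < α) (ha : 0 < a) (hρ : 0 ≤ ρ) :
    ∫⁻ y : Plane, (1 - nexp (fadingExponent α a ρ y)) =
      ENNReal.ofReal (Real.pi * a ^ (2 / α) * ρ ^ 2 * pathLossConst α) := by
  rcases hρ.eq_or_lt with rfl | hρ
  · simp [fadingExponent, Real.zero_rpow (show α ≠ 0 by linarith)]
  have hb : 0 < (a * ρ ^ α)⁻¹ := by positivity
  have hmain := lintegral_one_div_one_add_mul_norm_rpow hα hb
  have hval : ((a * ρ ^ α)⁻¹) ^ (-2 / α) = a ^ (2 / α) * ρ ^ 2 := by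
    rw [Real.inv_rpow (by positivity), ← Real.rpow_neg (by positivity),
      show -(-2 / α) = 2 / α by ring, Real.mul_rpow ha.le (by positivity),
      ← Real.rpow_mul hρ.le, mul_div_cancel₀ _ (by linarith : α ≠ 0)]
    norm_num
  rw [hval, ← mul_assoc] at hmain
  rw [← hmain]
  refine lintegral_congr_ae ?_
  filter_upwards [compl_mem_ae_iff.2 (measure_singleton (0 : Plane))] with y hy
  have hy : 0 < ‖y‖ := norm_pos_iff.2 hy
  have ht : 0 ≤ a * ρ ^ α * ‖y‖ ^ (-α) := by positivity
  rw [fadingExponent, nexp_ofReal_log ht, ← ENNReal.ofReal_one, ← ENNReal.ofReal_sub _ (by positivity)]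
  congr 1
  rw [Real.rpow_neg hy.le]
  have := Real.rpow_pos_of_pos hy α
  have := Real.rpow_pos_of_pos hρ α
  field_simp
  ring

/-! ### Sums over the labels of a configuration -/

/-- The labels that carry a base station of the configuration. -/
def Config.IsActive (c : Config) (q : Label) : Prop := (q.2 : ℕ∞) < (c q.1).1

instance (c : Config) (q : Label) : Decidable (c.IsActive q) :=
  inferInstanceAs (Decidable ((q.2 : ℕ∞) < (c q.1).1))

/-- The position of a base station. -/
def Config.loc (c : Config) (q : Label) : Plane := (c q.1).2 q.2

lemma configSum_eq_tsum (c : Config) (g : Tier → Plane → ℝ≥0∞) :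
    configSum c g = ∑' q : Label, if c.IsActive q then g q.1 (c.loc q) else 0 := by
  rw [ENNReal.tsum_prod', tsum_fintype]
  rfl

/-- Sum of `g i y` over the base stations other than `p`. -/
def exceptSum (c : Config) (p : Label) (g : Tier → Plane → ℝ≥0∞) : ℝ≥0∞ :=
  ∑' q : Label, if c.IsActive q ∧ q ≠ p then g q.1 (c.loc q) else 0

lemma tsum_mem_eq_tierCount (c : Config) (i : Tier) {A : Set Plane} [DecidablePred (· ∈ A)]
    (hA : MeasurableSet A) :
    ∑' n : ℕ, (if c.IsActive (i, n) ∧ c.loc (i, n) ∈ A then (1 : ℝ≥0∞) else 0) =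
      (tierCount c i A : ℝ≥0∞) := by
  have h := pointMeasure_apply (K := fun c : Config => (c i).1) (X := fun n c => (c i).2 n) c hA
  rw [tierCount, ← h, ← lintegral_indicator_one hA,
    lintegral_pointMeasure _ _ (measurable_one.indicator hA), pointSum]
  congr 1
  ext n
  simp only [ite_and, Set.indicator_apply, Pi.one_apply]
  rfl

lemma exists_unique_of_tierCount_eq_one {c : Config} {i : Tier} {A : Set Plane}
    (h : tierCount c i A = 1) :
    ∃ n, (c.IsActive (i, n) ∧ c.loc (i, n) ∈ A) ∧
      ∀ m, c.IsActive (i, m) → c.loc (i, m) ∈ A → m = n := by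
  obtain ⟨n, hn⟩ := Set.encard_eq_one.1 h
  have hn' : ∀ m, (c.IsActive (i, m) ∧ c.loc (i, m) ∈ A) ↔ m = n := fun m => by
    exact Set.ext_iff.1 hn m
  exact ⟨n, (hn' n).2 rfl, fun m h1 h2 => (hn' m).1 ⟨h1, h2⟩⟩

/-! ### Annuli of equal area -/

/-- Annuli that partition the punctured plane into sets of area `π ε`. -/
def annulus (ε : ℝ) (k : ℕ) : Set Plane := {y | k * ε < ‖y‖ ^ 2 ∧ ‖y‖ ^ 2 ≤ (k + 1) * ε}

lemma measurableSet_annulus (ε : ℝ) (k : ℕ) : MeasurableSet (annulus ε k) :=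
  (measurableSet_lt (measurable_const (a := k * ε))
    (by fun_prop : Measurable fun y : Plane => ‖y‖ ^ 2)).inter
    (measurableSet_le (by fun_prop : Measurable fun y : Plane => ‖y‖ ^ 2)
      (measurable_const (a := (k + 1) * ε)))

lemma volume_annulus {ε : ℝ} (hε : 0 < ε) (k : ℕ) :
    volume (annulus ε k) = ENNReal.ofReal (Real.pi * ε) := by
  have hball : ∀ r : ℝ, 0 ≤ r →
      volume (Metric.closedBall (0 : Plane) (√r)) = ENNReal.ofReal (r * Real.pi) := fun r hr => by
    rw [EuclideanSpace.volume_closedBall_fin_two, ← ENNReal.ofReal_pow (Real.sqrt_nonneg _),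
      Real.sq_sqrt hr, ENNReal.ofReal_mul hr]
  have heq : annulus ε k = Metric.closedBall (0 : Plane) (√((k + 1) * ε)) \
      Metric.closedBall (0 : Plane) (√(k * ε)) := by
    ext y
    simp only [annulus, Set.mem_ofPred_eq, Set.mem_sdiff, mem_closedBall_zero_iff, not_le]
    rw [Real.sqrt_lt (by positivity) (norm_nonneg y), Real.le_sqrt (norm_nonneg y) (by positivity)]
    exact and_comm
  rw [heq, measure_sdiff (Metric.closedBall_subset_closedBall (Real.sqrt_le_sqrt (by linarith)))
    Metric.isClosed_closedBall.measurableSet.nullMeasurableSet measure_closedBall_lt_top.ne,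
    hball _ (by positivity), hball _ (by positivity), ← ENNReal.ofReal_sub _ (by positivity)]
  congr 1
  ring

lemma tsum_annulus {ε : ℝ} (hε : 0 < ε) (y : Plane) (h : ℝ≥0∞) [Decidable (y ≠ 0)]
    [∀ k, Decidable (y ∈ annulus ε k)] :
    ∑' k : ℕ, (if y ∈ annulus ε k then h else 0) = if y ≠ 0 then h else 0 := by
  by_cases hy : y = 0
  · have : ∀ k, y ∉ annulus ε k := fun k hk => by
      have h1 := hk.1
      rw [hy] at h1
      have : 0 ≤ (k : ℝ) * ε := by positivity
      simp at h1
      linarith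
    simp only [this, if_false, tsum_zero]
    rw [if_neg (not_not.2 hy)]
  · have hpos : 0 < ‖y‖ ^ 2 / ε := by have := norm_pos_iff.2 hy; positivity
    -- Annuli are open inside and closed outside, so the index is a ceiling minus one; the ceiling
    -- vanishes only at the origin.
    have hmem : ∀ k, y ∈ annulus ε k ↔ ⌈‖y‖ ^ 2 / ε⌉₊ = k + 1 := by
      intro k
      rw [Nat.ceil_eq_iff k.succ_ne_zero]
      simp only [annulus, Set.mem_ofPred_eq, Nat.succ_eq_add_one, Nat.add_sub_cancel,
        lt_div_iff₀ hε, div_le_iff₀ hε]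
      push_cast
      rfl
    obtain ⟨m, hm⟩ := Nat.exists_eq_succ_of_ne_zero (Nat.ceil_pos.2 hpos).ne'
    rw [tsum_eq_single m, if_pos ((hmem m).2 hm), if_pos hy]
    intro k hk
    rw [if_neg]
    rw [hmem, hm]
    omega

/-! ### The expected number of winning base stations -/

/-- The exponent functional without the points of tier `i` in `A`. -/
def maskedExponent (α : ℝ) (a : Tier → ℝ) (ρ : ℝ) (i : Tier) (A : Set Plane) (j : Tier) :
    Plane → ℝ≥0∞ :=
  if j = i then Aᶜ.indicator (fadingExponent α (a j) ρ) else fadingExponent α (a j) ρ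

lemma maskedExponent_le (α : ℝ) (a : Tier → ℝ) (ρ : ℝ) (i : Tier) (A : Set Plane) (j : Tier)
    (y : Plane) : maskedExponent α a ρ i A j y ≤ fadingExponent α (a j) ρ y := by
  unfold maskedExponent
  split_ifs
  · exact Set.indicator_le_self _ _ _
  · exact le_rfl

lemma maskedExponent_of_mem (α : ℝ) (a : Tier → ℝ) (ρ : ℝ) (i : Tier) {A : Set Plane}
    {y : Plane} (hy : y ∈ A) : maskedExponent α a ρ i A i y = 0 := by
  simp [maskedExponent, hy]

lemma maskedExponent_of_not (α : ℝ) (a : Tier → ℝ) (ρ : ℝ) {i : Tier} {A : Set Plane} {j : Tier}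
    {y : Plane} (h : ¬ (j = i ∧ y ∈ A)) :
    maskedExponent α a ρ i A j y = fadingExponent α (a j) ρ y := by
  unfold maskedExponent
  split_ifs with hj
  · rw [Set.indicator_of_mem]
    exact fun hy => h ⟨hj, hy⟩
  · rfl

lemma measurable_maskedExponent (α : ℝ) (a : Tier → ℝ) (ρ : ℝ) (i : Tier) {A : Set Plane}
    (hA : MeasurableSet A) (j : Tier) : Measurable (maskedExponent α a ρ i A j) := by
  unfold maskedExponent
  split_ifs
  · exact (measurable_fadingExponent _ _ _).indicator hA.compl
  · exact measurable_fadingExponent _ _ _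

/-- Contribution of the base station `p` to the expected number of winners: the conditional
probability, given the positions, that `p` beats its interferers. -/
def winProb (α : ℝ) (a : Tier → ℝ) (c : Config) (p : Label) : ℝ≥0∞ :=
  nexp (exceptSum c p fun j => fadingExponent α (a j) ‖c.loc p‖)

/-- Shrinking the serving distance to `ρ` and dropping interferers both lower the exponent, and the
resulting bound is the same for all servers in `A`. -/
lemma tsum_winProb_le {α : ℝ} {a : Tier → ℝ} (hα : 0 ≤ α) (ha : ∀ j, 0 ≤ a j) (c : Config)
    (i : Tier) {A : Set Plane} [DecidablePred (· ∈ A)] (hA : MeasurableSet A) {ρ : ℝ} (hρ : 0 ≤ ρ)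
    (hle : ∀ y ∈ A, ρ ≤ ‖y‖) :
    ∑' n : ℕ, (if c.IsActive (i, n) ∧ c.loc (i, n) ∈ A then winProb α a c (i, n) else 0) ≤
      (tierCount c i A : ℝ≥0∞) * nexp (configSum c (maskedExponent α a ρ i A)) := by
  rw [← tsum_mem_eq_tierCount c i hA, ← ENNReal.tsum_mul_right]
  refine ENNReal.tsum_le_tsum fun n => ?_
  split_ifs with h
  · rw [one_mul]
    refine nexp_anti ?_
    rw [configSum_eq_tsum]
    refine ENNReal.tsum_le_tsum fun q => ?_
    by_cases hq : c.IsActive q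
    · by_cases hqp : q = (i, n)
      · subst hqp
        simp [maskedExponent_of_mem α a ρ i h.2]
      · rw [if_pos hq, if_pos ⟨hq, hqp⟩]
        exact (maskedExponent_le _ _ _ _ _ _ _).trans
          (fadingExponent_mono hα (ha _) hρ (hle _ h.2) _)
    · simp [hq]
  · exact zero_le

/-- If `A` holds exactly one point of tier `i`, the mask removes only the server itself, so
enlarging the serving distance to `ρ` can only raise the exponent. -/
lemma le_tsum_winProb {α : ℝ} {a : Tier → ℝ} (hα : 0 ≤ α) (ha : ∀ j, 0 ≤ a j) (c : Config)
    (i : Tier) {A : Set Plane} [DecidablePred (· ∈ A)] {ρ : ℝ} (hle : ∀ y ∈ A, ‖y‖ ≤ ρ) :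
    (if tierCount c i A = 1 then 1 else 0) * nexp (configSum c (maskedExponent α a ρ i A)) ≤
      ∑' n : ℕ, (if c.IsActive (i, n) ∧ c.loc (i, n) ∈ A then winProb α a c (i, n) else 0) := by
  split_ifs with h
  · obtain ⟨n, hn, huniq⟩ := exists_unique_of_tierCount_eq_one h
    refine le_trans ?_ (ENNReal.le_tsum n)
    rw [one_mul, if_pos hn]
    refine nexp_anti ?_
    rw [configSum_eq_tsum]
    refine ENNReal.tsum_le_tsum fun q => ?_
    split_ifs with h1 h2
    · rw [maskedExponent_of_not]
      · exact fadingExponent_mono hα (ha _) (norm_nonneg _) (hle _ hn.2) _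
      · rintro ⟨h3, h4⟩
        obtain ⟨j, m⟩ := q
        obtain rfl : j = i := h3
        exact h1.2 (by rw [huniq m h1.1 h4])
    · exact absurd h1.1 h2
    · exact zero_le
    · exact le_rfl
  · simp

/-- Decay rate, in the squared serving distance, of the probability to beat the interferers. -/
def decayRate (lam : Tier → ℝ) (α : ℝ) (a : Tier → ℝ) : ℝ :=
  Real.pi * pathLossConst α * ∑ j, lam j * a j ^ (2 / α)

/-- Linearity in `ρ ^ 2` is what makes the sum over annuli of equal area geometric. -/
lemma sum_lintegral_fadingExponent {lam : Tier → ℝ} (hlam : ∀ j, 0 ≤ lam j) {α : ℝ}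
    (hα : 2 < α) {a : Tier → ℝ} (ha : ∀ j, 0 < a j) {ρ : ℝ} (hρ : 0 ≤ ρ) :
    ∑ j, ENNReal.ofReal (lam j) * ∫⁻ y, (1 - nexp (fadingExponent α (a j) ρ y)) =
      ENNReal.ofReal (decayRate lam α a * ρ ^ 2) := by
  have hC := pathLossConst_pos hα
  have hpi := Real.pi_pos
  have h0 : ∀ j, 0 ≤ a j ^ (2 / α) := fun j => Real.rpow_nonneg (ha j).le _
  simp_rw [fun j => lintegral_fadingExponent hα (ha j) hρ]
  rw [decayRate, Finset.mul_sum, Finset.sum_mul, ENNReal.ofReal_sum_of_nonneg]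
  · refine Finset.sum_congr rfl fun j _ => ?_
    rw [← ENNReal.ofReal_mul (hlam j)]
    congr 1
    ring
  · intro j _
    have := h0 j
    have := hlam j
    positivity

/-! ### Expectation bounds on a single annulus -/

section Squeeze

variable {Ω : Type*} [MeasurableSpace Ω] {μ : Measure Ω} {lam : Tier → ℝ}

lemma Network.measurable_config (N : Network Ω μ lam) : Measurable N.config :=
  measurable_pi_lambda _ fun j =>
    (N.ppp j).measurable_num.prodMk (measurable_pi_lambda _ (N.ppp j).measurable_pos)

lemma measurable_tierCount (i : Tier) {A : Set Plane} (hA : MeasurableSet A) :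
    Measurable fun c : Config => tierCount c i A :=
  measurable_pointCount (measurable_fst.comp (measurable_pi_apply i))
    (fun n => (measurable_pi_apply n).comp (measurable_snd.comp (measurable_pi_apply i))) hA

lemma measurable_configSum {g : Tier → Plane → ℝ≥0∞} (hg : ∀ j, Measurable (g j)) :
    Measurable fun c : Config => configSum c g :=
  Finset.measurable_fun_sum _ fun j _ =>
    measurable_pointSum (K := fun c : Config => (c j).1) (X := fun n c => (c j).2 n)
      (measurable_fst.comp (measurable_pi_apply j))
      (fun n => (measurable_pi_apply n).comp (measurable_snd.comp (measurable_pi_apply j))) (hg j)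

lemma Network.lintegral_tierCount_cast (N : Network Ω μ lam) (hlam : ∀ j, 0 ≤ lam j) {i : Tier}
    {A : Set Plane} (hA : MeasurableSet A) (hAvol : volume A ≠ ∞) :
    ∫⁻ ω, (tierCount (N.config ω) i A : ℝ≥0∞) ∂μ = ENNReal.ofReal (lam i) * volume A := by
  rw [N.lintegral_tierCount hA hAvol (fun k => (k : ℝ≥0∞))]
  simp only [ENat.toENNReal_coe]
  rw [lintegral_cast_poissonMeasure]
  change ENNReal.ofReal _ = _
  rw [ENNReal.ofReal_mul (hlam i), ENNReal.ofReal_toReal hAvol]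

lemma Network.lintegral_tierCount_eq_one (N : Network Ω μ lam) (hlam : ∀ j, 0 ≤ lam j) {i : Tier}
    {A : Set Plane} (hA : MeasurableSet A) (hAvol : volume A ≠ ∞) :
    ∫⁻ ω, (if tierCount (N.config ω) i A = 1 then 1 else 0) ∂μ =
      ENNReal.ofReal (lam i * (volume A).toReal * Real.exp (-(lam i * (volume A).toReal))) := by
  rw [N.lintegral_tierCount hA hAvol (fun k => if k = 1 then 1 else 0), lintegral_poissonMeasure,
    tsum_eq_single 1]
  · rw [Real.coe_toNNReal _ (mul_nonneg (hlam i) ENNReal.toReal_nonneg)]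
    simp [mul_comm]
  · intro k hk
    rw [if_neg (by exact_mod_cast hk), mul_zero]

lemma Network.lintegral_upper (N : Network Ω μ lam) (hlam : ∀ j, 0 ≤ lam j) {α : ℝ}
    (hα : 2 < α) {a : Tier → ℝ} (ha : ∀ j, 0 < a j) {i : Tier} {A : Set Plane}
    (hA : MeasurableSet A) (hAvol : volume A ≠ ∞) {ρ : ℝ} (hρ : 0 ≤ ρ) :
    ∫⁻ ω, (tierCount (N.config ω) i A : ℝ≥0∞) *
        nexp (configSum (N.config ω) (maskedExponent α a ρ i A)) ∂μ ≤
      ENNReal.ofReal (lam i * (volume A).toReal * Real.exp (lam i * (volume A).toReal) *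
        Real.exp (-(decayRate lam α a * ρ ^ 2))) := by
  have hcount := N.lintegral_tierCount_cast hlam (i := i) hA hAvol
  have hfin : ∫⁻ ω, (tierCount (N.config ω) i A : ℝ≥0∞) ∂μ ≠ ∞ := by
    rw [hcount]; exact ENNReal.mul_ne_top ENNReal.ofReal_ne_top hAvol
  rw [N.laplace hlam hA hAvol (fun k => (k : ℝ≥0∞)) hfin
    (measurable_maskedExponent α a ρ i hA) (fun y hy => maskedExponent_of_mem α a ρ i hy), hcount]
  have hm : ENNReal.ofReal (lam i) * volume A = ENNReal.ofReal (lam i * (volume A).toReal) := by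
    rw [ENNReal.ofReal_mul (hlam i), ENNReal.ofReal_toReal hAvol]
  set m := lam i * (volume A).toReal with hmdef
  have hm0 : 0 ≤ m := mul_nonneg (hlam i) ENNReal.toReal_nonneg
  have hd0 : 0 ≤ decayRate lam α a * ρ ^ 2 := by
    have hC := pathLossConst_pos hα
    have hpi := Real.pi_pos
    have : 0 ≤ ∑ j, lam j * a j ^ (2 / α) :=
      Finset.sum_nonneg fun j _ => mul_nonneg (hlam j) (Real.rpow_nonneg (ha j).le _)
    unfold decayRate
    positivity
  set S := ∑ j, ENNReal.ofReal (lam j) * ∫⁻ y, (1 - nexp (maskedExponent α a ρ i A j y)) with hS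
  -- Since `1 - nexp ≤ 1`, masking costs at most the mean number `m` of points in `A`; hence the
  -- factor `exp m`, which tends to `1` as `A` shrinks.
  have hle : ENNReal.ofReal (decayRate lam α a * ρ ^ 2) ≤ S + ENNReal.ofReal m := by
    rw [← sum_lintegral_fadingExponent hlam hα ha hρ, ← hm, hS]
    have hj : ∀ j, ENNReal.ofReal (lam j) * ∫⁻ y, (1 - nexp (fadingExponent α (a j) ρ y)) ≤
        ENNReal.ofReal (lam j) * (∫⁻ y, (1 - nexp (maskedExponent α a ρ i A j y))) +
          if j = i then ENNReal.ofReal (lam j) * volume A else 0 := by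
      intro j
      by_cases hji : j = i
      · rw [if_pos hji, ← mul_add]
        refine mul_le_mul_right ?_ _
        rw [← lintegral_indicator_one hA, ← lintegral_add_right _ (measurable_one.indicator hA)]
        refine lintegral_mono fun y => ?_
        by_cases hy : y ∈ A
        · rw [Set.indicator_of_mem hy]
          exact tsub_le_self.trans le_add_self
        · rw [maskedExponent_of_not _ _ _ (fun h => hy h.2)]
          exact le_self_add
      · rw [if_neg hji, add_zero]
        simp_rw [fun y => maskedExponent_of_not α a ρ (A := A) (y := y) (fun h => hji h.1)]
        exact le_rfl
    refine (Finset.sum_le_sum fun j _ => hj j).trans ?_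
    rw [Finset.sum_add_distrib, Finset.sum_ite_eq' Finset.univ i, if_pos (Finset.mem_univ i)]
  have hexp : nexp S ≤ ENNReal.ofReal (Real.exp m * Real.exp (-(decayRate lam α a * ρ ^ 2))) := by
    have h1 := nexp_anti hle
    rw [nexp_add, nexp_ofReal hm0, nexp_ofReal hd0] at h1
    calc nexp S = ENNReal.ofReal (Real.exp m) * (nexp S * ENNReal.ofReal (Real.exp (-m))) := by
          rw [mul_left_comm, ← ENNReal.ofReal_mul (Real.exp_pos _).le, ← Real.exp_add]
          simp
      _ ≤ _ := by
          rw [ENNReal.ofReal_mul (Real.exp_pos _).le]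
          exact mul_le_mul_right h1 _
  rw [hm, mul_assoc, ENNReal.ofReal_mul hm0]
  exact mul_le_mul_right hexp _

/-- Here masking goes in the right direction and needs no correction; `exp (-m)` comes from the
probability `m exp (-m)` of exactly one point. -/
lemma Network.lintegral_lower (N : Network Ω μ lam) (hlam : ∀ j, 0 ≤ lam j) {α : ℝ}
    (hα : 2 < α) {a : Tier → ℝ} (ha : ∀ j, 0 < a j) {i : Tier} {A : Set Plane}
    (hA : MeasurableSet A) (hAvol : volume A ≠ ∞) {ρ : ℝ} (hρ : 0 ≤ ρ) :
    ENNReal.ofReal (lam i * (volume A).toReal * Real.exp (-(lam i * (volume A).toReal)) *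
        Real.exp (-(decayRate lam α a * ρ ^ 2))) ≤
      ∫⁻ ω, (if tierCount (N.config ω) i A = 1 then 1 else 0) *
        nexp (configSum (N.config ω) (maskedExponent α a ρ i A)) ∂μ := by
  have hcount := N.lintegral_tierCount_eq_one hlam (i := i) hA hAvol
  have hd0 : 0 ≤ decayRate lam α a * ρ ^ 2 := by
    have hC := pathLossConst_pos hα
    have hpi := Real.pi_pos
    have : 0 ≤ ∑ j, lam j * a j ^ (2 / α) :=
      Finset.sum_nonneg fun j _ => mul_nonneg (hlam j) (Real.rpow_nonneg (ha j).le _)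
    unfold decayRate
    positivity
  rw [N.laplace hlam hA hAvol (fun k => if k = 1 then 1 else 0)
    (by rw [hcount]; exact ENNReal.ofReal_ne_top)
    (measurable_maskedExponent α a ρ i hA) (fun y hy => maskedExponent_of_mem α a ρ i hy), hcount,
    ENNReal.ofReal_mul (mul_nonneg (mul_nonneg (hlam i) ENNReal.toReal_nonneg) (Real.exp_pos _).le),
    ← nexp_ofReal hd0, ← sum_lintegral_fadingExponent hlam hα ha hρ]
  refine mul_le_mul_right (nexp_anti (Finset.sum_le_sum fun j _ => mul_le_mul_right
    (lintegral_mono fun y => tsub_le_tsub_left (nexp_anti (maskedExponent_le _ _ _ _ _ _ _)) 1) _)) _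

end Squeeze

/-! ### Summation over the annuli and the limit of small area -/

lemma tendsto_div_one_sub_exp {κ : ℝ} (hκ : 0 < κ) :
    Tendsto (fun ε : ℝ => ε / (1 - Real.exp (-(κ * ε)))) (𝓝[>] 0) (𝓝 κ⁻¹) := by
  have hd : HasDerivAt (fun ε : ℝ => 1 - Real.exp (-(κ * ε))) κ 0 := by
    have h1 : HasDerivAt (fun ε : ℝ => -(κ * ε)) (-κ) 0 := by
      simpa using ((hasDerivAt_id' (0 : ℝ)).const_mul κ).fun_neg
    simpa using h1.exp.const_sub 1
  have h2 := (hasDerivAt_iff_tendsto_slope_zero.1 hd).mono_left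
    (nhdsWithin_mono 0 (fun x (hx : 0 < x) => hx.ne'))
  refine (h2.inv₀ hκ.ne').congr fun ε => ?_
  simp [div_eq_mul_inv, mul_comm]

lemma tsum_ofReal_geometric {M κ ε : ℝ} (hM : 0 ≤ M) (hκε : 0 < κ * ε) :
    ∑' k : ℕ, ENNReal.ofReal (M * Real.exp (-(κ * (k * ε)))) =
      ENNReal.ofReal (M / (1 - Real.exp (-(κ * ε)))) := by
  have h := (hasSum_geometric_of_lt_one (Real.exp_pos (-(κ * ε))).le
    (Real.exp_lt_one_iff.mpr (by linarith))).mul_left M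
  rw [div_eq_mul_inv, ← h.tsum_eq, ENNReal.ofReal_tsum_of_nonneg (fun k => by positivity) h.summable]
  congr 1
  ext k
  rw [← Real.exp_nat_mul]
  congr 3
  ring

open Classical in
/-- The expected number of base stations of tier `i` that beat their interferers. -/
theorem Network.lintegral_tsum_winProb {Ω : Type*} [MeasurableSpace Ω] {μ : Measure Ω}
    {lam : Tier → ℝ} (N : Network Ω μ lam) (hlam : ∀ j, 0 ≤ lam j) {α : ℝ}
    (hα : 2 < α) {a : Tier → ℝ} (ha : ∀ j, 0 < a j) (hκ : 0 < decayRate lam α a) (i : Tier) :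
    ∫⁻ ω, ∑' n : ℕ, (if (N.config ω).IsActive (i, n) ∧ (N.config ω).loc (i, n) ≠ 0 then
        winProb α a (N.config ω) (i, n) else 0) ∂μ =
      ENNReal.ofReal (lam i * Real.pi / decayRate lam α a) := by
  set κ := decayRate lam α a with hκdef
  set I := ∫⁻ ω, ∑' n : ℕ, (if (N.config ω).IsActive (i, n) ∧ (N.config ω).loc (i, n) ≠ 0 then
        winProb α a (N.config ω) (i, n) else 0) ∂μ with hI
  -- The annuli miss the origin, which is why `loc ≠ 0` is imposed.
  have hsplit : ∀ ε : ℝ, 0 < ε → I = ∫⁻ ω, ∑' k : ℕ, ∑' n : ℕ,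
      (if (N.config ω).IsActive (i, n) ∧ (N.config ω).loc (i, n) ∈ annulus ε k then
        winProb α a (N.config ω) (i, n) else 0) ∂μ := by
    intro ε hε
    refine lintegral_congr fun ω => ?_
    rw [ENNReal.tsum_comm]
    congr 1
    ext n
    simp only [ite_and]
    split_ifs with h1 h2
    · rw [tsum_annulus hε, if_pos h2]
    · rw [tsum_annulus hε, if_neg h2]
    · simp
  have hvol : ∀ ε : ℝ, 0 < ε → ∀ k, volume (annulus ε k) ≠ ∞ := fun ε hε k => by
    rw [volume_annulus hε]; exact ENNReal.ofReal_ne_top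
  have hvolr : ∀ ε : ℝ, 0 < ε → ∀ k, (volume (annulus ε k)).toReal = Real.pi * ε :=
    fun ε hε k => by
      rw [volume_annulus hε, ENNReal.toReal_ofReal (by have := Real.pi_pos; positivity)]
  have hmeas : ∀ (ε : ℝ) (k : ℕ) (ρ : ℝ), Measurable fun ω =>
      nexp (configSum (N.config ω) (maskedExponent α a ρ i (annulus ε k))) := fun ε k ρ =>
    measurable_nexp.comp ((measurable_configSum (measurable_maskedExponent α a ρ i
      (measurableSet_annulus ε k))).comp N.measurable_config)
  have hcm : ∀ (ε : ℝ) (k : ℕ) (φ : ℕ∞ → ℝ≥0∞), Measurable fun ω =>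
      φ (tierCount (N.config ω) i (annulus ε k)) := fun ε k φ =>
    Measurable.comp .of_discrete
      ((measurable_tierCount i (measurableSet_annulus ε k)).comp N.measurable_config)
  have hupper : ∀ ε : ℝ, 0 < ε → I ≤ ENNReal.ofReal
      (lam i * Real.pi * Real.exp (lam i * (Real.pi * ε)) *
        (ε / (1 - Real.exp (-(κ * ε))))) := by
    intro ε hε
    have hpi := Real.pi_pos
    have hli := hlam i
    rw [hsplit ε hε]
    calc _ ≤ ∫⁻ ω, ∑' k : ℕ, (tierCount (N.config ω) i (annulus ε k) : ℝ≥0∞) *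
            nexp (configSum (N.config ω) (maskedExponent α a √(k * ε) i (annulus ε k))) ∂μ :=
          lintegral_mono fun ω => ENNReal.tsum_le_tsum fun k =>
            tsum_winProb_le (by linarith) (fun j => (ha j).le) _ i (measurableSet_annulus ε k)
              (Real.sqrt_nonneg _) (fun y hy => (Real.sqrt_le_left (norm_nonneg y)).2 hy.1.le)
      _ = ∑' k : ℕ, ∫⁻ ω, (tierCount (N.config ω) i (annulus ε k) : ℝ≥0∞) *
            nexp (configSum (N.config ω) (maskedExponent α a √(k * ε) i (annulus ε k))) ∂μ :=
          lintegral_tsum fun k => ((hcm ε k fun n => (n : ℝ≥0∞)).mul (hmeas ε k _)).aemeasurable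
      _ ≤ ∑' k : ℕ, ENNReal.ofReal ((lam i * (Real.pi * ε) * Real.exp (lam i * (Real.pi * ε))) *
            Real.exp (-(κ * (k * ε)))) := by
          refine ENNReal.tsum_le_tsum fun k => ?_
          have := N.lintegral_upper hlam hα ha (i := i) (measurableSet_annulus ε k) (hvol ε hε k)
            (Real.sqrt_nonneg (k * ε))
          rwa [hvolr ε hε, Real.sq_sqrt (by positivity)] at this
      _ = _ := by
          rw [tsum_ofReal_geometric (by positivity) (by positivity)]
          congr 1
          ring
  -- The outer squared radius `(k + 1) ε` produces the extra factor `exp (-κ ε)`.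
  have hlower : ∀ ε : ℝ, 0 < ε → ENNReal.ofReal
      (lam i * Real.pi * Real.exp (-(lam i * (Real.pi * ε))) * Real.exp (-(κ * ε)) *
        (ε / (1 - Real.exp (-(κ * ε))))) ≤ I := by
    intro ε hε
    have hpi := Real.pi_pos
    have hli := hlam i
    rw [hsplit ε hε]
    rw [← ge_iff_le]
    calc _ ≥ ∫⁻ ω, ∑' k : ℕ, (if tierCount (N.config ω) i (annulus ε k) = 1 then 1 else 0) *
            nexp (configSum (N.config ω)
              (maskedExponent α a √((k + 1) * ε) i (annulus ε k))) ∂μ :=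
          lintegral_mono fun ω => ENNReal.tsum_le_tsum fun k =>
            le_tsum_winProb (by linarith) (fun j => (ha j).le) _ i
              (fun y hy => Real.le_sqrt_of_sq_le hy.2)
      _ = ∑' k : ℕ, ∫⁻ ω, (if tierCount (N.config ω) i (annulus ε k) = 1 then 1 else 0) *
            nexp (configSum (N.config ω)
              (maskedExponent α a √((k + 1) * ε) i (annulus ε k))) ∂μ :=
          lintegral_tsum fun k =>
            ((hcm ε k fun n => if n = 1 then 1 else 0).mul (hmeas ε k _)).aemeasurable
      _ ≥ ∑' k : ℕ, ENNReal.ofReal ((lam i * (Real.pi * ε) * Real.exp (-(lam i * (Real.pi * ε))) *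
            Real.exp (-(κ * ε))) * Real.exp (-(κ * (k * ε)))) := by
          refine ENNReal.tsum_le_tsum fun k => ?_
          have := N.lintegral_lower hlam hα ha (i := i) (measurableSet_annulus ε k) (hvol ε hε k)
            (Real.sqrt_nonneg ((k + 1) * ε))
          rw [hvolr ε hε, Real.sq_sqrt (by positivity)] at this
          refine le_trans (le_of_eq ?_) this
          rw [mul_assoc _ (Real.exp (-(κ * ε))), ← Real.exp_add]
          congr 3
          ring
      _ = _ := by
          rw [tsum_ofReal_geometric (by positivity) (by positivity)]
          congr 1
          ring
  have hlim := tendsto_div_one_sub_exp hκ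
  -- `f` collects the correction factors by which the two bounds differ.
  have hcont : ∀ f : ℝ → ℝ, Continuous f → f 0 = 1 → Tendsto (fun ε : ℝ => ENNReal.ofReal
      (lam i * Real.pi * f ε * (ε / (1 - Real.exp (-(κ * ε)))))) (𝓝[>] 0)
      (𝓝 (ENNReal.ofReal (lam i * Real.pi / κ))) := by
    intro f hf hf0
    have h1 : Tendsto f (𝓝[>] 0) (𝓝 1) := hf0 ▸ (hf.tendsto 0).mono_left nhdsWithin_le_nhds
    have := ((h1.const_mul (lam i * Real.pi)).mul hlim)
    rw [mul_one, ← div_eq_mul_inv] at this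
    exact (ENNReal.continuous_ofReal.tendsto _).comp this
  refine le_antisymm ?_ ?_
  · refine ge_of_tendsto (hcont (fun ε => Real.exp (lam i * (Real.pi * ε))) (by fun_prop)
      (by simp)) ?_
    filter_upwards [self_mem_nhdsWithin] with ε hε using hupper ε hε
  · refine le_of_tendsto (hcont (fun ε => Real.exp (-(lam i * (Real.pi * ε))) *
      Real.exp (-(κ * ε))) (by fun_prop) (by simp)) ?_
    filter_upwards [self_mem_nhdsWithin] with ε hε
    simpa only [mul_assoc] using hlower ε hε

/-! ### Rayleigh fading -/

lemma expMeasure_lt_ofReal (y : ℝ≥0∞) : expMeasure 1 {h : ℝ | y < ENNReal.ofReal h} = nexp y := by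
  have := isProbabilityMeasure_expMeasure one_pos
  rcases eq_or_ne y ∞ with rfl | hy
  · simp
  obtain ⟨r, rfl⟩ : ∃ r : ℝ≥0, y = r := ⟨_, (ENNReal.coe_toNNReal hy).symm⟩
  have hset : {h : ℝ | (r : ℝ≥0∞) < ENNReal.ofReal h} = (Set.Iic (r : ℝ))ᶜ := by
    ext h
    simp only [Set.mem_ofPred_eq, Set.mem_compl_iff, Set.mem_Iic, not_le]
    rw [← ENNReal.ofReal_coe_nnreal, ENNReal.ofReal_lt_ofReal_iff_of_nonneg r.coe_nonneg]
  have hcdf : (expMeasure 1) (Set.Iic (r : ℝ)) = ENNReal.ofReal (1 - Real.exp (-r)) := by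
    rw [← ofReal_cdf, cdf_expMeasure_eq one_pos, if_pos r.coe_nonneg, one_mul]
  have h1 : Real.exp (-r) ≤ 1 := Real.exp_le_one_iff.2 (neg_nonpos.2 r.coe_nonneg)
  rw [hset, prob_compl_eq_one_sub measurableSet_Iic, hcdf, ← ENNReal.ofReal_coe_nnreal,
    nexp_ofReal r.coe_nonneg, ← ENNReal.ofReal_one, ← ENNReal.ofReal_sub _ (by linarith)]
  congr 1
  ring

lemma lintegral_nexp_expMeasure {t : ℝ} (ht : 0 ≤ t) :
    ∫⁻ h, nexp (ENNReal.ofReal t * ENNReal.ofReal h) ∂expMeasure 1 =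
      nexp (ENNReal.ofReal (Real.log (1 + t))) := by
  rw [nexp_ofReal_log ht, ← lintegral_exp_neg_mul (by positivity)]
  have hpdf : Measurable (exponentialPDF 1) := (measurable_exponentialPDFReal 1).ennreal_ofReal
  change ∫⁻ h, nexp (ENNReal.ofReal t * ENNReal.ofReal h) ∂(volume.withDensity (exponentialPDF 1)) = _
  rw [lintegral_withDensity_eq_lintegral_mul _ hpdf (by fun_prop),
    ← lintegral_indicator measurableSet_Ioi]
  refine lintegral_congr_ae ?_
  filter_upwards [compl_mem_ae_iff.2 (measure_singleton (0 : ℝ))] with h hh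
  rcases lt_or_gt_of_ne (show h ≠ 0 from hh) with h0 | h0
  · rw [Set.indicator_of_notMem (by simpa using h0.le), Pi.mul_apply, exponentialPDF_of_neg h0,
      zero_mul]
  · rw [Set.indicator_of_mem (by exact h0), Pi.mul_apply, exponentialPDF_of_nonneg h0.le,
      ← ENNReal.ofReal_mul ht, nexp_ofReal (by positivity), ← ENNReal.ofReal_mul (by positivity),
      one_mul, one_mul, ← Real.exp_add]
    congr 2
    ring

/-- The σ-algebra is a variable so that it can be the one generated by all gains but one; the
excluded gain has coefficient zero. -/
lemma measurable_tsum_ofReal_mul {Ω ι : Type*} [Countable ι] {m : MeasurableSpace Ω}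
    {h : ι → Ω → ℝ} {t : ι → ℝ} (ht : ∀ q, t q = 0 ∨ Measurable (h q)) :
    Measurable fun ω => ∑' q, ENNReal.ofReal (t q) * ENNReal.ofReal (h q ω) := by
  refine Measurable.tsum fun q => ?_
  rcases ht q with hq | hq
  · simp [hq]
  · exact hq.ennreal_ofReal.const_mul _

section Gains

variable {Ω : Type*} [MeasurableSpace Ω] {μ : Measure Ω} {ι : Type*} [Countable ι]
  {h : ι → Ω → ℝ}

/-- Independence gives the product over finite sets of links; dominated convergence, with bound `1`,
passes to all of them, even when the sum diverges. -/
lemma lintegral_nexp_tsum_gain (hm : ∀ q, Measurable (h q)) (hlaw : ∀ q, HasLaw (h q) (expMeasure 1) μ)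
    (hind : iIndepFun h μ) {t : ι → ℝ} (ht : ∀ q, 0 ≤ t q) :
    ∫⁻ ω, nexp (∑' q, ENNReal.ofReal (t q) * ENNReal.ofReal (h q ω)) ∂μ =
      nexp (∑' q, ENNReal.ofReal (Real.log (1 + t q))) := by
  have : IsProbabilityMeasure μ := hind.isProbabilityMeasure
  have hterm : ∀ q, Measurable fun x : ℝ => nexp (ENNReal.ofReal (t q) * ENNReal.ofReal x) :=
    fun q => by fun_prop
  have hone : ∀ q, ∫⁻ ω, nexp (ENNReal.ofReal (t q) * ENNReal.ofReal (h q ω)) ∂μ =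
      nexp (ENNReal.ofReal (Real.log (1 + t q))) := fun q => by
    rw [← lintegral_nexp_expMeasure (ht q), ← (hlaw q).map_eq, lintegral_map (hterm q) (hm q)]
  have hfin : ∀ s : Finset ι,
      ∫⁻ ω, nexp (∑ q ∈ s, ENNReal.ofReal (t q) * ENNReal.ofReal (h q ω)) ∂μ =
        nexp (∑ q ∈ s, ENNReal.ofReal (Real.log (1 + t q))) := fun s => by
    have := lintegral_prod_eq_prod_lintegral_of_indepFun s _ (hind.comp _ hterm)
      (fun q => (hterm q).comp (hm q))
    simp only [Function.comp_apply, hone] at this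
    simpa only [nexp_sum] using this
  have hL : Tendsto (fun s : Finset ι =>
      ∫⁻ ω, nexp (∑ q ∈ s, ENNReal.ofReal (t q) * ENNReal.ofReal (h q ω)) ∂μ) atTop
      (𝓝 (∫⁻ ω, nexp (∑' q, ENNReal.ofReal (t q) * ENNReal.ofReal (h q ω)) ∂μ)) := by
    refine tendsto_lintegral_filter_of_dominated_convergence (fun _ => 1)
      (Eventually.of_forall fun s => ?_)
      (Eventually.of_forall fun s => ae_of_all _ fun ω => nexp_le_one _) (by simp)
      (ae_of_all _ fun ω => (continuous_nexp.tendsto _).comp ENNReal.summable.hasSum)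
    exact measurable_nexp.comp (Finset.measurable_fun_sum s fun q _ =>
      ((hm q).ennreal_ofReal.const_mul _))
  refine tendsto_nhds_unique hL ?_
  simp_rw [hfin]
  exact (continuous_nexp.tendsto _).comp ENNReal.summable.hasSum

lemma indepFun_gain_tsum (hm : ∀ q, Measurable (h q)) (hind : iIndepFun h μ) (p : ι) {t : ι → ℝ}
    (hp : t p = 0) :
    IndepFun (fun ω => ∑' q, ENNReal.ofReal (t q) * ENNReal.ofReal (h q ω)) (h p) μ := by
  have hi : iIndep (fun q => MeasurableSpace.comap (h q) inferInstance) μ := hind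
  have hS := indep_iSup_of_disjoint (fun q => (hm q).comap_le) hi
    (show Disjoint ({p}ᶜ : Set ι) {p} from disjoint_compl_left)
  refine IndepFun_iff_Indep _ _ _ |>.2 (indep_of_indep_of_le_left
    (indep_of_indep_of_le_right hS ?_) ?_)
  · exact le_iSup₂_of_le p rfl le_rfl
  · rw [← measurable_iff_comap_le]
    refine measurable_tsum_ofReal_mul fun q => ?_
    by_cases hq : q = p
    · exact Or.inl (hq ▸ hp)
    · have hle : MeasurableSpace.comap (h q) inferInstance ≤
          ⨆ i ∈ ({p}ᶜ : Set ι), MeasurableSpace.comap (h i) inferInstance :=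
        le_iSup₂_of_le q hq le_rfl
      exact Or.inr ((comap_measurable (h q)).mono hle le_rfl)

/-- Conditioning on the sum `Y`, the exponential tail gives `P(h p > Y) = E exp (-Y)`. The condition
`t p = 0` makes `Y` independent of `h p`. -/
lemma measure_tsum_gain_lt (hm : ∀ q, Measurable (h q))
    (hlaw : ∀ q, HasLaw (h q) (expMeasure 1) μ) (hind : iIndepFun h μ) (p : ι) {t : ι → ℝ}
    (ht : ∀ q, 0 ≤ t q) (hp : t p = 0) :
    μ {ω | ∑' q, ENNReal.ofReal (t q) * ENNReal.ofReal (h q ω) < ENNReal.ofReal (h p ω)} =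
      nexp (∑' q, ENNReal.ofReal (Real.log (1 + t q))) := by
  have : IsProbabilityMeasure μ := hind.isProbabilityMeasure
  have := isProbabilityMeasure_expMeasure one_pos
  set Y : Ω → ℝ≥0∞ := fun ω => ∑' q, ENNReal.ofReal (t q) * ENNReal.ofReal (h q ω) with hY
  have hYm : Measurable Y := measurable_tsum_ofReal_mul fun q => Or.inr (hm q)
  have hmap := (indepFun_iff_map_prod_eq_prod_map_map hYm.aemeasurable (hm p).aemeasurable).1
    (indepFun_gain_tsum hm hind p hp)
  rw [(hlaw p).map_eq] at hmap
  have hset : MeasurableSet {z : ℝ≥0∞ × ℝ | z.1 < ENNReal.ofReal z.2} :=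
    measurableSet_lt measurable_fst measurable_snd.ennreal_ofReal
  have h1 : μ {ω | Y ω < ENNReal.ofReal (h p ω)} =
      (μ.map fun ω => (Y ω, h p ω)) {z : ℝ≥0∞ × ℝ | z.1 < ENNReal.ofReal z.2} := by
    rw [Measure.map_apply (hYm.prodMk (hm p)) hset]
    rfl
  rw [h1, hmap, Measure.prod_apply hset, ← lintegral_nexp_tsum_gain hm hlaw hind ht,
    lintegral_map (measurable_measure_prodMk_left hset) hYm]
  refine lintegral_congr fun ω => ?_
  exact expMeasure_lt_ofReal (Y ω)

end Gains

/-! ### The winning event -/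

/-- The relative power, per unit of path loss, of the interferer `q` against the server `p`;
zero if `q` does not interfere. -/
def relativePower (α : ℝ) (a : Tier → ℝ) (c : Config) (p q : Label) : ℝ :=
  if c.IsActive q ∧ q ≠ p then a q.1 * ‖c.loc p‖ ^ α * ‖c.loc q‖ ^ (-α) else 0

lemma relativePower_nonneg (α : ℝ) {a : Tier → ℝ} (ha : ∀ j, 0 ≤ a j) (c : Config) (p q : Label) :
    0 ≤ relativePower α a c p q := by
  have := ha q.1
  unfold relativePower
  split_ifs <;> positivity

/-- The base station `p` is active, off the origin, and its faded power beats the relative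
interference. -/
def Wins (α : ℝ) (a : Tier → ℝ) (p : Label) (c : Config) (h : Tier → ℕ → ℝ) : Prop :=
  (c.IsActive p ∧ c.loc p ≠ 0) ∧
    ∑' q : Label, ENNReal.ofReal (relativePower α a c p q) * ENNReal.ofReal (h q.1 q.2) <
      ENNReal.ofReal (h p.1 p.2)

lemma measurable_loc (q : Label) : Measurable fun c : Config => c.loc q :=
  (measurable_pi_apply q.2).comp (measurable_snd.comp (measurable_pi_apply q.1))

lemma measurableSet_isActive (q : Label) : MeasurableSet {c : Config | c.IsActive q} :=
  (measurable_fst.comp (measurable_pi_apply q.1))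
    (MeasurableSet.of_discrete (s := {k : ℕ∞ | (q.2 : ℕ∞) < k}))

lemma measurable_relativePower (α : ℝ) (a : Tier → ℝ) (p q : Label) :
    Measurable fun c => relativePower α a c p q := by
  have h1 := (measurable_loc p).norm
  have h2 := (measurable_loc q).norm
  refine Measurable.ite ((measurableSet_isActive q).inter (MeasurableSet.const _)) ?_
    measurable_const
  fun_prop

lemma measurableSet_wins (α : ℝ) (a : Tier → ℝ) (p : Label) :
    MeasurableSet {z : Config × (Tier → ℕ → ℝ) | Wins α a p z.1 z.2} := by
  have hgain : ∀ q : Label, Measurable fun z : Config × (Tier → ℕ → ℝ) => z.2 q.1 q.2 := fun q =>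
    (measurable_pi_apply q.2).comp ((measurable_pi_apply q.1).comp measurable_snd)
  refine MeasurableSet.inter (MeasurableSet.inter (measurable_fst (measurableSet_isActive p)) ?_) ?_
  · exact ((measurable_loc p).comp measurable_fst) (measurableSet_singleton 0).compl
  · exact measurableSet_lt (Measurable.tsum fun q =>
      (((measurable_relativePower α a p q).comp measurable_fst).ennreal_ofReal.mul
        (hgain q).ennreal_ofReal)) (hgain p).ennreal_ofReal

section Network

variable {Ω : Type*} [MeasurableSpace Ω] {μ : Measure Ω} {lam : Tier → ℝ}

/-- All gains of a network. -/
def Network.gains (N : Network Ω μ lam) (ω : Ω) : Tier → ℕ → ℝ := fun i n => N.gain i n ω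

lemma Network.measurable_gains (N : Network Ω μ lam) : Measurable N.gains :=
  measurable_pi_lambda _ fun i => measurable_pi_lambda _ fun n => N.measurable_gain i n

open Classical in
lemma Network.measure_wins_config (N : Network Ω μ lam) {α : ℝ} {a : Tier → ℝ}
    (ha : ∀ j, 0 ≤ a j) (p : Label) (c : Config) :
    μ {ω | Wins α a p c (N.gains ω)} =
      if c.IsActive p ∧ c.loc p ≠ 0 then winProb α a c p else 0 := by
  by_cases hc : c.IsActive p ∧ c.loc p ≠ 0
  · have hset : {ω | Wins α a p c (N.gains ω)} = {ω | ∑' q : Label,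
        ENNReal.ofReal (relativePower α a c p q) * ENNReal.ofReal (N.gain q.1 q.2 ω) <
          ENNReal.ofReal (N.gain p.1 p.2 ω)} := Set.ext fun ω => and_iff_right hc
    rw [if_pos hc, hset]
    have h1 := measure_tsum_gain_lt (h := fun (q : Label) => N.gain q.1 q.2)
      (fun q => N.measurable_gain _ _) (fun q => N.law_gain _ _) N.indep_gain p
      (relativePower_nonneg α ha c p) (by simp [relativePower])
    refine h1.trans ?_
    unfold winProb exceptSum
    congr 2
    ext q
    unfold relativePower fadingExponent
    split_ifs <;> simp
  · simp only [Wins, hc, if_false, false_and]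
    exact measure_empty

lemma Network.map_config_gains [IsFiniteMeasure μ] (N : Network Ω μ lam) :
    μ.map (fun ω => (N.config ω, N.gains ω)) = (μ.map N.config).prod (μ.map N.gains) :=
  (indepFun_iff_map_prod_eq_prod_map_map N.measurable_config.aemeasurable
    N.measurable_gains.aemeasurable).1 N.indep_pos_gain

open Classical in
-- Positions and gains are independent, so Tonelli reduces to a frozen configuration.
lemma Network.measure_wins [IsFiniteMeasure μ] (N : Network Ω μ lam) {α : ℝ} {a : Tier → ℝ}
    (ha : ∀ j, 0 ≤ a j) (p : Label) :
    μ {ω | Wins α a p (N.config ω) (N.gains ω)} =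
      ∫⁻ ω, (if (N.config ω).IsActive p ∧ (N.config ω).loc p ≠ 0 then
        winProb α a (N.config ω) p else 0) ∂μ := by
  have hW := measurableSet_wins α a p
  have h1 : μ {ω | Wins α a p (N.config ω) (N.gains ω)} =
      (μ.map fun ω => (N.config ω, N.gains ω)) {z | Wins α a p z.1 z.2} := by
    rw [Measure.map_apply (N.measurable_config.prodMk N.measurable_gains) hW]
    rfl
  rw [h1, N.map_config_gains, Measure.prod_apply hW,
    lintegral_map (measurable_measure_prodMk_left hW) N.measurable_config]
  refine lintegral_congr fun ω => ?_
  rw [Measure.map_apply N.measurable_gains (measurable_prodMk_left hW),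
    ← N.measure_wins_config ha p (N.config ω)]
  rfl

open Classical in
-- The function is the measure of the sections of the measurable set of wins.
lemma Network.measurable_winProb [IsFiniteMeasure μ] (N : Network Ω μ lam) {α : ℝ} {a : Tier → ℝ}
    (ha : ∀ j, 0 ≤ a j) (p : Label) :
    Measurable fun ω => if (N.config ω).IsActive p ∧ (N.config ω).loc p ≠ 0 then
        winProb α a (N.config ω) p else 0 := by
  have h := (measurable_measure_prodMk_left (ν := μ.map N.gains)
    (measurableSet_wins α a p)).comp N.measurable_config
  convert h using 1
  ext ω
  rw [Function.comp_apply, Measure.map_apply N.measurable_gains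
    (measurable_prodMk_left (measurableSet_wins α a p)), ← N.measure_wins_config ha p (N.config ω)]
  rfl

/-- The expected number of winners of a tier. -/
theorem Network.tsum_measure_wins [IsFiniteMeasure μ] (N : Network Ω μ lam)
    (hlam : ∀ j, 0 ≤ lam j) {α : ℝ} (hα : 2 < α) {a : Tier → ℝ} (ha : ∀ j, 0 < a j)
    (hκ : 0 < decayRate lam α a) (i : Tier) :
    ∑' n : ℕ, μ {ω | Wins α a (i, n) (N.config ω) (N.gains ω)} =
      ENNReal.ofReal (lam i * Real.pi / decayRate lam α a) := by
  classical
  rw [← N.lintegral_tsum_winProb hlam hα ha hκ i,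
    lintegral_tsum fun n => (N.measurable_winProb (fun j => (ha j).le) (i, n)).aemeasurable]
  exact tsum_congr fun n => N.measure_wins (fun j => (ha j).le) (i, n)

end Network

/-! ### Success events -/

section Success

variable {Ω : Type*} [MeasurableSpace Ω] {μ : Measure Ω} {lam : Tier → ℝ}

/-- Zero and infinite interference are included: `0 / 0 = 0` settles `I = H = 0`, and `η > 0`
settles `I = ∞`. -/
lemma ofReal_lt_div_iff {η C : ℝ} (hη : 0 < η) (hC : 0 < C) {H I : ℝ≥0∞} (hH : H ≠ ∞) :
    ENNReal.ofReal η < ENNReal.ofReal C * H / I ↔ ENNReal.ofReal (η / C) * I < H := by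
  have hC0 : ENNReal.ofReal C ≠ 0 := by simpa using hC
  have hη0 : ENNReal.ofReal η ≠ 0 := by simpa using hη
  have hb : ENNReal.ofReal C * H ≠ ∞ := ENNReal.mul_ne_top ENNReal.ofReal_ne_top hH
  have h1 : ENNReal.ofReal η < ENNReal.ofReal C * H / I ↔
      ENNReal.ofReal η * I < ENNReal.ofReal C * H := by
    rcases eq_or_ne I 0 with rfl | hI0
    · rcases eq_or_ne H 0 with rfl | hH0
      · simp
      · rw [ENNReal.div_zero (mul_ne_zero hC0 hH0)]
        simp [pos_iff_ne_zero, hC0, hH0]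
    · rcases eq_or_ne I ∞ with rfl | hIt
      · rw [ENNReal.div_top, ENNReal.mul_top hη0]
        simp
      · exact ENNReal.lt_div_iff_mul_lt (Or.inl hI0) (Or.inl hIt)
  rw [h1, ENNReal.ofReal_div_of_pos hC,
    ← ENNReal.mul_lt_mul_iff_right (b := _ / _ * I) hC0 ENNReal.ofReal_ne_top,
    ← mul_assoc, ENNReal.mul_div_cancel hC0 ENNReal.ofReal_ne_top]

/-- Power of a tier `j` interferer relative to the power and threshold of a tier `i` server. -/
def powerRatio (P η : Tier → ℝ) (ζ υ : ℝ) (i j : Tier) : ℝ :=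
  η i * (interferenceFactor υ i j * P j) / (servingFactor ζ i * P i)

lemma interferenceFactor_pos {υ : ℝ} (hυ : 0 < υ) (i j : Tier) : 0 < interferenceFactor υ i j := by
  cases i <;> cases j <;> simp [interferenceFactor, hυ]

lemma servingFactor_pos {ζ : ℝ} (hζ : 0 < ζ) (i : Tier) : 0 < servingFactor ζ i := by
  cases i <;> simp [servingFactor, hζ]

lemma Network.interference_eq (N : Network Ω μ lam) (P : Tier → ℝ) (α υ : ℝ) (p : Label) (ω : Ω) :
    N.interference P α υ p ω = ∑' q : Label, if (N.config ω).IsActive q ∧ q ≠ p then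
      ENNReal.ofReal (interferenceFactor υ p.1 q.1 * N.rxPower P α q ω) else 0 := by
  classical
  refine (tsum_subtype {q : Label | N.Active ω q ∧ q ≠ p}
    (fun q => ENNReal.ofReal (interferenceFactor υ p.1 q.1 * N.rxPower P α q ω))).trans ?_
  congr 1
  ext q
  rw [Set.indicator_apply]
  congr 1

lemma Network.active_and_lt_sinr_iff (N : Network Ω μ lam) {P η : Tier → ℝ} {α ζ υ : ℝ}
    (hP : ∀ i, 0 < P i) (hη : ∀ i, 0 < η i) (hα : 0 < α) (hζ : 0 < ζ) (hυ : 0 < υ) (p : Label)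
    (ω : Ω) :
    (N.Active ω p ∧ ENNReal.ofReal (η p.1) < N.sinr P α ζ υ 0 p ω) ↔
      Wins α (powerRatio P η ζ υ p.1) p (N.config ω) (N.gains ω) := by
  unfold Wins
  rw [and_assoc]
  refine and_congr_right fun _ => ?_
  have hloc : (N.config ω).loc p = N.pos p.1 p.2 ω := rfl
  -- At the origin `0 ^ (-α) = 0`, so the received power is zero and the station cannot win.
  by_cases hr : N.pos p.1 p.2 ω = 0
  · simp [hloc, hr, Network.sinr, Network.rxPower, Real.zero_rpow (neg_ne_zero.2 hα.ne')]
  have hr0 : 0 < ‖N.pos p.1 p.2 ω‖ := norm_pos_iff.2 hr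
  rw [and_iff_right (show (N.config ω).loc p ≠ 0 from hr)]
  have hs := servingFactor_pos hζ p.1
  have hPp := hP p.1
  have hC : 0 < servingFactor ζ p.1 * P p.1 * ‖N.pos p.1 p.2 ω‖ ^ (-α) := by positivity
  have hnum : ENNReal.ofReal (servingFactor ζ p.1 * N.rxPower P α p ω) =
      ENNReal.ofReal (servingFactor ζ p.1 * P p.1 * ‖N.pos p.1 p.2 ω‖ ^ (-α)) *
        ENNReal.ofReal (N.gain p.1 p.2 ω) := by
    rw [← ENNReal.ofReal_mul hC.le, Network.rxPower]
    congr 1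
    ring
  rw [Network.sinr, hnum, ENNReal.ofReal_zero, add_zero,
    ofReal_lt_div_iff (hη p.1) hC ENNReal.ofReal_ne_top, N.interference_eq,
    ← ENNReal.tsum_mul_left]
  refine iff_of_eq (congrArg₂ _ (tsum_congr fun q => ?_) rfl)
  have hPq := hP q.1
  have hf := interferenceFactor_pos hυ p.1 q.1
  have hηp := hη p.1
  unfold relativePower
  split_ifs
  · rw [← ENNReal.ofReal_mul (by positivity), ← ENNReal.ofReal_mul (by
      unfold powerRatio; positivity)]
    congr 1
    rw [hloc, show (N.config ω).loc q = N.pos q.1 q.2 ω from rfl, powerRatio, Network.rxPower,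
      Network.gains, Real.rpow_neg hr0.le]
    have := Real.rpow_pos_of_pos hr0 α
    field_simp
  · simp

/-- Keeping only `q` in the denominator gives `η f S_q < s S_p`, where `f` and `s` are the
interference and serving factors; `hdom` says `s < η f`. -/
lemma Network.lt_of_lt_sinr (N : Network Ω μ lam) {P η : Tier → ℝ} {α ζ υ σ2 : ℝ}
    (hη : ∀ i, 0 < η i) (hζ : 0 < ζ)
    (hdom : ∀ i j, servingFactor ζ i < η i * interferenceFactor υ i j) {p q : Label} {ω : Ω}
    (hpq : q ≠ p) (hq : N.Active ω q) (hq0 : 0 < N.rxPower P α q ω)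
    (h : ENNReal.ofReal (η p.1) < N.sinr P α ζ υ σ2 p ω) :
    N.rxPower P α q ω < N.rxPower P α p ω := by
  have hle : ENNReal.ofReal (interferenceFactor υ p.1 q.1 * N.rxPower P α q ω) ≤
      N.interference P α υ p ω + ENNReal.ofReal σ2 := by
    refine le_trans ?_ le_self_add
    rw [N.interference_eq]
    refine le_trans ?_ (ENNReal.le_tsum q)
    rw [if_pos ⟨hq, hpq⟩]
  have h1 := ENNReal.mul_lt_of_lt_div (h.trans_le (ENNReal.div_le_div_left hle _))
  rw [← ENNReal.ofReal_mul (hη _).le] at h1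
  have h2 := (ENNReal.ofReal_lt_ofReal_iff'.1 h1).1
  have h3 := hdom p.1 q.1
  have hs := servingFactor_pos hζ p.1
  by_contra hcon
  push Not at hcon
  nlinarith [mul_lt_mul_of_pos_right h3 hq0, mul_le_mul_of_nonneg_left hcon hs.le]

lemma Network.rxPower_pos_of_lt_sinr (N : Network Ω μ lam) {P : Tier → ℝ} {α ζ υ σ2 : ℝ}
    (hζ : 0 < ζ) {p : Label} {ω : Ω} {x : ℝ≥0∞} (h : x < N.sinr P α ζ υ σ2 p ω) :
    0 < N.rxPower P α p ω := by
  by_contra hcon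
  push Not at hcon
  rw [Network.sinr, ENNReal.ofReal_of_nonpos
    (mul_nonpos_of_nonneg_of_nonpos (servingFactor_pos hζ _).le hcon), ENNReal.zero_div] at h
  exact not_lt_zero h

/-- At most one base station exceeds its threshold. -/
lemma Network.eq_of_lt_sinr (N : Network Ω μ lam) {P η : Tier → ℝ} {α ζ υ σ2 : ℝ}
    (hη : ∀ i, 0 < η i) (hζ : 0 < ζ)
    (hdom : ∀ i j, servingFactor ζ i < η i * interferenceFactor υ i j) {p q : Label} {ω : Ω}
    (hp : N.Active ω p) (hq : N.Active ω q)
    (h1 : ENNReal.ofReal (η p.1) < N.sinr P α ζ υ σ2 p ω)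
    (h2 : ENNReal.ofReal (η q.1) < N.sinr P α ζ υ σ2 q ω) : p = q := by
  by_contra hne
  exact lt_asymm
    (N.lt_of_lt_sinr hη hζ hdom (Ne.symm hne) hq (N.rxPower_pos_of_lt_sinr hζ h2) h1)
    (N.lt_of_lt_sinr hη hζ hdom hne hp (N.rxPower_pos_of_lt_sinr hζ h1) h2)

lemma Network.successProb_zero_eq_sum [IsFiniteMeasure μ] (N : Network Ω μ lam)
    (hlam : ∀ j, 0 ≤ lam j) (hlamR : 0 < lam .rrh) {P η : Tier → ℝ} {α ζ υ : ℝ}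
    (hP : ∀ i, 0 < P i) (hη : ∀ i, 0 < η i) (hα : 2 < α) (hζ : 0 < ζ) (hυ : 0 < υ)
    (hdom : ∀ i j, servingFactor ζ i < η i * interferenceFactor υ i j) :
    N.successProb P η α ζ υ 0 =
      ∑ i, lam i * Real.pi / decayRate lam α (powerRatio P η ζ υ i) := by
  have ha : ∀ i j, 0 < powerRatio P η ζ υ i j := fun i j => by
    have := hP i
    have := hP j
    have := hη i
    have := servingFactor_pos hζ i
    have := interferenceFactor_pos hυ i j
    unfold powerRatio
    positivity
  -- The RRH tier alone makes the rate positive; the other densities may vanish.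
  have hκ : ∀ i, 0 < decayRate lam α (powerRatio P η ζ υ i) := fun i => by
    refine mul_pos (mul_pos Real.pi_pos (pathLossConst_pos hα))
      (Finset.sum_pos' (fun j _ => mul_nonneg (hlam j) (Real.rpow_nonneg (ha i j).le _))
        ⟨.rrh, Finset.mem_univ _, mul_pos hlamR (Real.rpow_pos_of_pos (ha i .rrh) _)⟩)
  let E : Label → Set Ω := fun p =>
    {ω | Wins α (powerRatio P η ζ υ p.1) p (N.config ω) (N.gains ω)}
  have hE : ∀ p ω, ω ∈ E p ↔ N.Active ω p ∧ ENNReal.ofReal (η p.1) < N.sinr P α ζ υ 0 p ω :=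
    fun p ω => (N.active_and_lt_sinr_iff hP hη (by linarith) hζ hυ p ω).symm
  have hset : {ω | ∃ q : Label, N.Active ω q ∧
      ENNReal.ofReal (η q.1) < N.sinr P α ζ υ 0 q ω} = ⋃ p, E p := by
    ext ω
    simp only [Set.mem_ofPred_eq, Set.mem_iUnion, hE]
  have hmeas : ∀ p, MeasurableSet (E p) := fun p =>
    (N.measurable_config.prodMk N.measurable_gains) (measurableSet_wins α _ p)
  have hdisj : Pairwise (Function.onFun Disjoint E) := fun p q hpq =>
    Set.disjoint_left.2 fun ω h1 h2 => hpq (by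
      rw [hE] at h1 h2
      exact N.eq_of_lt_sinr hη hζ hdom h1.1 h2.1 h1.2 h2.2)
  have hnn : ∀ i, 0 ≤ lam i * Real.pi / decayRate lam α (powerRatio P η ζ υ i) := fun i =>
    div_nonneg (mul_nonneg (hlam i) Real.pi_pos.le) (hκ i).le
  rw [Network.successProb, hset, measureReal_def, measure_iUnion hdisj hmeas, ENNReal.tsum_prod',
    tsum_fintype]
  have : ∀ i, ∑' n, μ (E (i, n)) =
      ENNReal.ofReal (lam i * Real.pi / decayRate lam α (powerRatio P η ζ υ i)) := fun i =>
    N.tsum_measure_wins hlam hα (ha i) (hκ i) i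
  simp_rw [this]
  rw [← ENNReal.ofReal_sum_of_nonneg fun i _ => hnn i,
    ENNReal.toReal_ofReal (Finset.sum_nonneg fun i _ => hnn i)]

/-- The server's power and threshold are common to all interferers and factor out of the rate; `π`
cancels. -/
lemma mul_pi_div_decayRate {lam P η : Tier → ℝ} {α ζ υ : ℝ} (hP : ∀ i, 0 < P i)
    (hη : ∀ i, 0 < η i) (hζ : 0 < ζ) (hυ : 0 < υ) (i : Tier) :
    lam i * Real.pi / decayRate lam α (powerRatio P η ζ υ i) =
      lam i * (servingFactor ζ i * P i) ^ (2 / α) * η i ^ (-(2 / α)) /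
        (pathLossConst α * ∑ j, lam j * (interferenceFactor υ i j * P j) ^ (2 / α)) := by
  have hs := mul_pos (servingFactor_pos hζ i) (hP i)
  have hsum : ∑ j, lam j * powerRatio P η ζ υ i j ^ (2 / α) =
      η i ^ (2 / α) / (servingFactor ζ i * P i) ^ (2 / α) *
        ∑ j, lam j * (interferenceFactor υ i j * P j) ^ (2 / α) := by
    rw [Finset.mul_sum]
    refine Finset.sum_congr rfl fun j _ => ?_
    have hf := mul_pos (interferenceFactor_pos hυ i j) (hP j)
    rw [powerRatio, Real.div_rpow (mul_pos (hη i) hf).le hs.le, Real.mul_rpow (hη i).le hf.le]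
    ring
  rw [decayRate, hsum, Real.rpow_neg (hη i).le]
  have h1 := Real.rpow_pos_of_pos hs (2 / α)
  have h2 := Real.rpow_pos_of_pos (hη i) (2 / α)
  have h3 := Real.pi_pos
  field_simp

theorem Network.successProb_zero [IsFiniteMeasure μ] (N : Network Ω μ lam)
    (hlam : ∀ j, 0 ≤ lam j) (hlamR : 0 < lam .rrh) {P η : Tier → ℝ} {α ζ υ : ℝ}
    (hP : ∀ i, 0 < P i) (hη : ∀ i, 0 < η i) (hα : 2 < α) (hζ : 0 < ζ) (hυ : 0 < υ)
    (hdom : ∀ i j, servingFactor ζ i < η i * interferenceFactor υ i j) :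
    N.successProb P η α ζ υ 0 = closedForm lam P η α ζ υ := by
  rw [N.successProb_zero_eq_sum hlam hlamR hP hη hα hζ hυ hdom]
  simp_rw [fun i => mul_pi_div_decayRate (lam := lam) (α := α) hP hη hζ hυ i]
  simp only [sum_tier, servingFactor, interferenceFactor, one_mul, closedForm]
  ring_nf

/-! ### Vanishing noise -/

lemma Network.sinr_anti (N : Network Ω μ lam) (P : Tier → ℝ) (α ζ υ : ℝ) (p : Label) (ω : Ω)
    {s t : ℝ} (h : s ≤ t) : N.sinr P α ζ υ t p ω ≤ N.sinr P α ζ υ s p ω :=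
  ENNReal.div_le_div_left (add_le_add_right (ENNReal.ofReal_le_ofReal h) _) _

lemma Network.tendsto_sinr (N : Network Ω μ lam) (P : Tier → ℝ) (α ζ υ : ℝ) (p : Label) (ω : Ω) :
    Tendsto (fun s => N.sinr P α ζ υ s p ω) (𝓝 0) (𝓝 (N.sinr P α ζ υ 0 p ω)) := by
  unfold Network.sinr
  exact ENNReal.Tendsto.const_div
    (tendsto_const_nhds.add (ENNReal.continuous_ofReal.tendsto 0)) (Or.inr ENNReal.ofReal_ne_top)

/-- Less noise enlarges the success event, and as the threshold inequality is strict, the event at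
zero noise is the union of those at noise `1 / (n + 1)`. Continuity from below and monotonicity
conclude. -/
theorem Network.tendsto_successProb [IsFiniteMeasure μ] (N : Network Ω μ lam) (P η : Tier → ℝ)
    (α ζ υ : ℝ) :
    Tendsto (fun s => N.successProb P η α ζ υ s) (𝓝[>] 0) (𝓝 (N.successProb P η α ζ υ 0)) := by
  let S : ℝ → Set Ω := fun s =>
    {ω | ∃ q : Label, N.Active ω q ∧ ENNReal.ofReal (η q.1) < N.sinr P α ζ υ s q ω}
  have hanti : ∀ s t, s ≤ t → S t ⊆ S s := fun s t hst ω ⟨q, hq, h⟩ =>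
    ⟨q, hq, h.trans_le (N.sinr_anti P α ζ υ q ω hst)⟩
  have hU : ⋃ n : ℕ, S (1 / ((n : ℝ) + 1)) = S 0 := by
    refine Set.Subset.antisymm (Set.iUnion_subset fun n => hanti _ _ (by positivity)) ?_
    rintro ω ⟨q, hq, h⟩
    have hev := ((N.tendsto_sinr P α ζ υ q ω).comp tendsto_one_div_add_atTop_nhds_zero_nat).eventually
      (lt_mem_nhds h)
    obtain ⟨n, hn⟩ := hev.exists
    exact Set.mem_iUnion.2 ⟨n, q, hq, hn⟩
  have hseq : Tendsto (fun n : ℕ => μ (S (1 / ((n : ℝ) + 1)))) atTop (𝓝 (μ (S 0))) := by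
    rw [← hU]
    refine tendsto_measure_iUnion_atTop fun m n hmn => hanti _ _ ?_
    have : (m : ℝ) ≤ n := by exact_mod_cast hmn
    gcongr
  refine (ENNReal.tendsto_toReal (measure_ne_top μ (S 0))).comp (f := fun s => μ (S s)) ?_
  refine tendsto_order.2 ⟨fun b hb => ?_, fun b hb => ?_⟩
  · obtain ⟨n, hn⟩ := (hseq.eventually (lt_mem_nhds hb)).exists
    filter_upwards [Ioo_mem_nhdsGT (show (0 : ℝ) < 1 / ((n : ℝ) + 1) by positivity)] with s hs
    exact hn.trans_le (measure_mono (hanti _ _ hs.2.le))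
  · filter_upwards [self_mem_nhdsWithin] with s hs
    exact (measure_mono (hanti _ _ (le_of_lt hs))).trans_lt hb

/-! ### Latency -/

/-- For `γ ≤ ρ` the truncated difference is `0` and `L / 0 = ∞`, so an overloaded station fails on
both sides. -/
lemma latency_lt_iff {γ : ℝ≥0∞} {L ρ D β : ℝ} (hL : 0 < L) (hρ : 0 ≤ ρ) (hD : 0 ≤ D)
    (hDβ : D < β) :
    ENNReal.ofReal L / (γ - ENNReal.ofReal ρ) + ENNReal.ofReal D < ENNReal.ofReal β ↔
      ENNReal.ofReal (ρ + L / (β - D)) < γ := by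
  have hd : 0 < β - D := sub_pos.2 hDβ
  have hd0 : ENNReal.ofReal (β - D) ≠ 0 := by simpa using hd
  have hL0 : ENNReal.ofReal L ≠ 0 := by simpa using hL
  rw [← lt_tsub_iff_right, ← ENNReal.ofReal_sub _ hD, ENNReal.ofReal_add hρ (by positivity),
    add_comm, ← lt_tsub_iff_right, ENNReal.ofReal_div_of_pos hd,
    ENNReal.div_lt_iff (Or.inr hL0) (Or.inr ENNReal.ofReal_ne_top),
    ENNReal.div_lt_iff (Or.inl hd0) (Or.inl ENNReal.ofReal_ne_top), mul_comm]

end Success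

/-! ### Limited feedback coefficients -/

/-- With `x = n + 1` this is `x β(x, y) < 1`, hence `ζ > 0`. Raising `n` multiplies the sides by `n
+ 2` and by the larger `n + 1 + y`; the base case is `Γ y < y Γ y`. -/
lemma Gamma_mul_Gamma_lt {y : ℝ} (hy : 1 < y) (n : ℕ) :
    Real.Gamma ((n : ℝ) + 2) * Real.Gamma y < Real.Gamma ((n : ℝ) + 1 + y) := by
  have hG := Real.Gamma_pos_of_pos (show 0 < y by linarith)
  induction n with
  | zero =>
    rw [Nat.cast_zero, zero_add, zero_add, add_comm 1 y, Real.Gamma_add_one (by linarith),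
      Real.Gamma_two]
    nlinarith
  | succ n ih =>
    have h1 : Real.Gamma (((n + 1 : ℕ) : ℝ) + 2) = ((n : ℝ) + 2) * Real.Gamma ((n : ℝ) + 2) := by
      rw [← Real.Gamma_add_one (by positivity)]
      push_cast
      ring_nf
    have h2 : Real.Gamma (((n + 1 : ℕ) : ℝ) + 1 + y) =
        ((n : ℝ) + 1 + y) * Real.Gamma ((n : ℝ) + 1 + y) := by
      rw [← Real.Gamma_add_one (by positivity)]
      push_cast
      ring_nf
    have h3 : 0 < Real.Gamma ((n : ℝ) + 2) * Real.Gamma y :=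
      mul_pos (Real.Gamma_pos_of_pos (by positivity)) hG
    rw [h1, h2, mul_assoc]
    exact mul_lt_mul (by linarith) ih.le h3 (by positivity)

lemma zeta_pos (B : ℕ) {NB : ℕ} (hNB : 2 ≤ NB) : 0 < zeta B NB := by
  have hN : (2 : ℝ) ≤ NB := by exact_mod_cast hNB
  have hy : 1 < (NB : ℝ) / (NB - 1) := by rw [one_lt_div (by linarith)]; linarith
  obtain ⟨m, hm⟩ := Nat.exists_eq_succ_of_ne_zero (pow_ne_zero B (two_ne_zero : (2 : ℕ) ≠ 0))
  have hx : (2 : ℝ) ^ B = m + 1 := by exact_mod_cast hm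
  have h := Gamma_mul_Gamma_lt hy m
  have hpos : 0 < Real.Gamma ((m : ℝ) + 1 + (NB : ℝ) / (NB - 1)) :=
    Real.Gamma_pos_of_pos (by positivity)
  rw [zeta, ProbabilityTheory.beta, hx, sub_pos, ← mul_div_assoc, div_lt_one hpos, ← mul_assoc,
    ← Real.Gamma_add_one (by positivity), add_assoc, one_add_one_eq_two]
  exact h

lemma upsilon_pos (B NB : ℕ) : 0 < upsilon B NB := Real.rpow_pos_of_pos two_pos _

lemma upsilon_le_one (B : ℕ) {NB : ℕ} (hNB : 2 ≤ NB) : upsilon B NB ≤ 1 := by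
  have hN : (2 : ℝ) ≤ NB := by exact_mod_cast hNB
  refine Real.rpow_le_one_of_one_le_of_nonpos one_le_two ?_
  rw [neg_nonpos]
  exact div_nonneg (Nat.cast_nonneg B) (by linarith)

/-- For an RRH server, `ζ / υ < η` treats RRH interferers; since `υ ≤ 1` it also gives `ζ < η`,
which treats F-AP interferers. -/
lemma servingFactor_lt {η : Tier → ℝ} {ζ υ : ℝ} (hζ : 0 < ζ) (hυ : 0 < υ) (hυ1 : υ ≤ 1)
    (hηc : 1 < η .cached) (hηu : 1 < η .uncached) (hηR : ζ / υ < η .rrh) (i j : Tier) :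
    servingFactor ζ i < η i * interferenceFactor υ i j := by
  have h1 : ζ < η .rrh * υ := (div_lt_iff₀ hυ).1 hηR
  have h2 : ζ < η .rrh := lt_of_le_of_lt ((le_div_iff₀ hυ).2 (mul_le_of_le_one_right hζ.le hυ1)) hηR
  cases i <;> cases j <;> simpa [servingFactor, interferenceFactor]

lemma density_nonneg {lamF lamR pHit : ℝ} (hF : 0 < lamF) (hR : 0 < lamR) (h0 : 0 ≤ pHit)
    (h1 : pHit ≤ 1) (i : Tier) : 0 ≤ density lamF lamR pHit i := by
  cases i
  · exact mul_nonneg h0 hF.le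
  · exact mul_nonneg (sub_nonneg.2 h1) hF.le
  · exact hR.le

end

end FRAN

theorem corollary4 {Ω : Type*} [MeasurableSpace Ω] (μ : Measure Ω) [IsProbabilityMeasure μ]
    (lamF lamR pHit : ℝ) (hlamF : 0 < lamF) (hlamR : 0 < lamR)
    (hpHit0 : 0 ≤ pHit) (hpHit1 : pHit ≤ 1)
    (N : FRAN.Network Ω μ (FRAN.density lamF lamR pHit))
    (P η : FRAN.Tier → ℝ) (hP : ∀ i, 0 < P i)
    (α : ℝ) (hα : 2 < α) (B NB : ℕ) (hNB : 2 ≤ NB)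
    (hηc : 1 < η .cached) (hηu : 1 < η .uncached)
    (hηR : FRAN.zeta B NB / FRAN.upsilon B NB < η .rrh) :
    Tendsto (fun σ2 : ℝ => N.successProb P η α (FRAN.zeta B NB) (FRAN.upsilon B NB) σ2)
      (𝓝[>] 0)
      (𝓝 (FRAN.closedForm (FRAN.density lamF lamR pHit) P η α
        (FRAN.zeta B NB) (FRAN.upsilon B NB))) ∧
    N.successProb P η α (FRAN.zeta B NB) (FRAN.upsilon B NB) 0 =
      FRAN.closedForm (FRAN.density lamF lamR pHit) P η α
        (FRAN.zeta B NB) (FRAN.upsilon B NB) ∧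
    (∀ (L : ℝ) (ρ D β : FRAN.Tier → ℝ), 0 < L → (∀ i, 0 ≤ ρ i) → (∀ i, 0 ≤ D i) →
      (∀ i, D i < β i) → (∀ i, η i = ρ i + L / (β i - D i)) →
      ∀ σ2 : ℝ, 0 ≤ σ2 →
        N.latencySuccessProb P α (FRAN.zeta B NB) (FRAN.upsilon B NB) σ2 L ρ D β =
          N.successProb P η α (FRAN.zeta B NB) (FRAN.upsilon B NB) σ2) := by
  have hζ := FRAN.zeta_pos B hNB
  have hυ := FRAN.upsilon_pos B NB
  have hdom := FRAN.servingFactor_lt hζ hυ (FRAN.upsilon_le_one B hNB) hηc hηu hηR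
  -- Positivity of all thresholds is read off from the domination inequality at `j = i`.
  have hη : ∀ i, 0 < η i := fun i => pos_of_mul_pos_left
    ((FRAN.servingFactor_pos hζ i).trans (hdom i i)) (FRAN.interferenceFactor_pos hυ i i).le
  have hzero := N.successProb_zero (FRAN.density_nonneg hlamF hlamR hpHit0 hpHit1) hlamR hP hη hα
    hζ hυ hdom
  refine ⟨hzero ▸ N.tendsto_successProb P η α _ _, hzero, ?_⟩
  intro L ρ D β hL hρ hD hDβ hηeq σ2 _
  unfold FRAN.Network.latencySuccessProb FRAN.Network.successProb FRAN.Network.latency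
  simp_rw [fun i => hηeq i, fun (q : FRAN.Label) ω => FRAN.latency_lt_iff
    (γ := N.sinr P α (FRAN.zeta B NB) (FRAN.upsilon B NB) σ2 q ω) hL (hρ q.1) (hD q.1) (hDβ q.1)]
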